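/- Let $G$ be a finite graph, in which loops and multiple edges are allowed, and suppose that every vertex of $G$ has degree at most $4$ (a loop contributes $2$ to the degree of its vertex). Then $G$ has a strong edge-coloring with at most $22$ colors, that is, one can assign to each edge of $G$ one of $22$ colors so that any two distinct edges $e \ne f$ receive different colors whenever $e$ and $f$ have a common endpoint, or some edge of $G$ joins an endpoint of $e$ to an endpoint of $f$. -/

import Mathlib

namespace Graph

/-- The degree of a vertex of a multigraph, as an extended natural number: the number of edges
incident to it, where a loop counts twice. -/
noncomputable def degree {α β : Type*} (G : Graph α β) (x : α) : ℕ∞ :=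
  (G.incidenceSet x).encard + (G.loopSet x).encard

/-- Distinct edges with a common endpoint receive distinct colors.
(Only the values of `c` on edges of `G` matter.) -/
def IsProperEdgeColoring {α β C : Type*} (G : Graph α β) (c : β → C) : Prop :=
  ∀ ⦃e f : β⦄ ⦃x : α⦄, G.Inc e x → G.Inc f x → e ≠ f → c e ≠ c f

/-- A proper edge-coloring in which, moreover, the first and the last edge of a path `w x y z` of
length three never receive the same color. The vertices are not required to be distinct: this
changes nothing for loopless graphs, since then distinct `e` and `f` have a common endpoint as soon
as two of the vertices coincide, and it lets a loop `e` (the case `w = x`) conflict with the edges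
at distance one from it. -/
structure IsStrongEdgeColoring {α β C : Type*} (G : Graph α β) (c : β → C) : Prop where
  proper : G.IsProperEdgeColoring c
  ne_of_path : ∀ ⦃e g f : β⦄ ⦃w x y z : α⦄,
    G.IsLink e w x → G.IsLink g x y → G.IsLink f y z → e ≠ f → c e ≠ c f

end Graph

/-! An edge conflicts with at most 24 others: 3 at each end, and 3 more beyond each of those. Color
a component greedily towards a root `v`, the edges at `v` last. A set `P` of pairwise
non-conflicting edges not incident to `v` gets color `0` at the outset. Away from `v` one can always
color an edge with an end adjacent to a vertex `p` none of whose edges outside `P` is colored yet;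
this leaves at most 20 colored conflicts outside `P`, and `P` blocks one more color, so 22 colors
suffice. If all of `P` conflicts with the four edges at `v`, each of these saves `P.card - 1`
colors. In the order `e₄, e₃, e₂, e₁` they still have 3, 2, 1, 0 uncolored companions, so it is
enough that `e₃, e₂, e₁` have at most 23, 22, 21 conflicts, up to that saving (`IsRoot.of_star_eq`).

Under the degree bound, a vertex with at most 3 edges (so any vertex with a loop), with two parallel
edges, or in a triangle is a root with `P` empty. Otherwise the component is simple, 4-regular and
triangle-free, and each 4-cycle through an edge removes one of its conflicts
(`card_conflictFinset_add_squareCount_le`). Few 4-cycles must then be balanced by a large `P`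
(`exists_isGoodRoot`): if some edge lies on two 4-cycles, two edges in `P` suffice, or else some
vertex has all its edges on three 4-cycles; if there are 4-cycles but no two share an edge, `P` has
three edges; with no 4-cycle at all, `P` has four, one beyond each neighbor of `v`. -/

namespace StrongEdgeColoring

/-! ### Good roots: definitions and independent transversals -/

variable {α : Type*}

/-- `N` restricts to the neighborhood function of a 4-regular triangle-free graph on `K`. -/
structure IsTriangleFreeOn (N : α → Finset α) (K : Set α) : Prop where
  mem : ∀ ⦃x⦄, x ∈ K → ∀ ⦃y⦄, y ∈ N x → y ∈ K
  symm : ∀ ⦃x⦄, x ∈ K → ∀ ⦃y⦄, y ∈ N x → x ∈ N y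
  card : ∀ ⦃x⦄, x ∈ K → (N x).card = 4
  tri : ∀ ⦃x⦄, x ∈ K → ∀ ⦃y⦄, y ∈ N x → ∀ ⦃z⦄, z ∈ N x → z ∉ N y

/-- The edges `q` and `q'`, whose first endpoints have a common neighbor in a triangle-free graph,
have distinct first endpoints and are not in conflict. -/
def Separated (N : α → Finset α) (q q' : α × α) : Prop :=
  q.1 ≠ q'.1 ∧ q.2 ∉ N q'.1 ∧ q'.2 ∉ N q.1 ∧ q.2 ∉ N q'.2

theorem IsTriangleFreeOn.separated_symm {N : α → Finset α} {K : Set α}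
    (hK : IsTriangleFreeOn N K) {q q' : α × α} (h : q.2 ∈ K) (hs : Separated N q q') :
    Separated N q' q :=
  ⟨hs.1.symm, hs.2.2.1, hs.2.1, fun hadj => hs.2.2.2 (hK.symm h hadj)⟩

/-- Three pairs of vertices, with at most a matching between any two of them and no triangle,
have an independent transversal. -/
theorem exists_independent_transversal {r : α → α → Prop} {A B C : Finset α}
    (hA : 1 < A.card) (hB : 1 < B.card) (hC : 1 < C.card)
    (hAB : ∀ a ∈ A, ∀ b ∈ B, ∀ b' ∈ B, r a b → r a b' → b = b')
    (hAC : ∀ a ∈ A, ∀ c ∈ C, ∀ c' ∈ C, r a c → r a c' → c = c')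
    (hCA : ∀ c ∈ C, ∀ a ∈ A, ∀ a' ∈ A, r a c → r a' c → a = a')
    (hBC : ∀ b ∈ B, ∀ c ∈ C, ∀ c' ∈ C, r b c → r b c' → c = c')
    (hCB : ∀ c ∈ C, ∀ b ∈ B, ∀ b' ∈ B, r b c → r b' c → b = b')
    (htri : ∀ a ∈ A, ∀ b ∈ B, ∀ c ∈ C, r a b → r a c → ¬ r b c) :
    ∃ a ∈ A, ∃ b ∈ B, ∃ c ∈ C, ¬ r a b ∧ ¬ r a c ∧ ¬ r b c := by
  by_contra hcon
  push Not at hcon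
  obtain ⟨a, ha, a', ha', haa⟩ := Finset.one_lt_card.1 hA
  have hb : ∃ b ∈ B, ∃ b' ∈ B, b ≠ b' ∧ ¬ r a b := by
    obtain ⟨b, hb, b', hb', hbb⟩ := Finset.one_lt_card.1 hB
    by_cases h : r a b
    · exact ⟨b', hb', b, hb, hbb.symm, fun h' => hbb (hAB a ha b hb b' hb' h h')⟩
    · exact ⟨b, hb, b', hb', hbb, h⟩
  obtain ⟨b, hb, b', hb', hbb, nab⟩ := hb
  -- Every member of `C` is adjacent to `a` or `b`, and neither of these can be adjacent to two, so
  -- each takes one.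
  have hc : ∃ c ∈ C, ∃ c' ∈ C, c ≠ c' ∧ r a c ∧ r b c' := by
    obtain ⟨c, hc, c', hc', hcc⟩ := Finset.one_lt_card.1 hC
    by_cases h : r a c
    · have h' : ¬ r a c' := fun h' => hcc (hAC a ha c hc c' hc' h h')
      exact ⟨c, hc, c', hc', hcc, h, hcon a ha b hb c' hc' nab h'⟩
    · have h1 := hcon a ha b hb c hc nab h
      refine ⟨c', hc', c, hc, hcc.symm, ?_, h1⟩
      by_contra h2
      exact hcc (hBC b hb c hc c' hc' h1 (hcon a ha b hb c' hc' nab h2))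
  obtain ⟨c, hc, c', hc', hcc, hac, hbc'⟩ := hc
  have nac' : ¬ r a c' := fun h => hcc (hAC a ha c hc c' hc' hac h)
  have nbc : ¬ r b c := fun h => hcc (hBC b hb c hc c' hc' h hbc')
  -- The same forcing applied to `a, b', c'` and to `a', b, c` makes `a', b', c` leave only `r b'
  -- c`, which closes the triangle `a, b', c`.
  have hab' : r a b' := by
    by_contra h
    exact hbb (hCB c' hc' b hb b' hb' hbc' (hcon a ha b' hb' c' hc' h nac'))
  have na'c : ¬ r a' c := fun h => haa (hCA c hc a ha a' ha' hac h)
  have ha'b : r a' b := by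
    by_contra h
    exact nbc (hcon a' ha' b hb c hc h na'c)
  have na'b' : ¬ r a' b' := fun h => hbb (hAB a' ha' b hb b' hb' ha'b h)
  exact htri a ha b' hb' c hc hab' hac (hcon a' ha' b' hb' c hc na'b' na'c)

variable [DecidableEq α]

/-- The number of 4-cycles `v, u, w, y` through the edge `vu`, for the graph with neighborhood
function `N`. -/
def squareCount (N : α → Finset α) (v u : α) : ℕ :=
  (((N v).erase u ×ˢ (N u).erase v).filter fun q => q.2 ∈ N q.1).card

/-- A set `Q` of pairwise non-conflicting edges at distance one from `v`, such that giving all of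
them the same color allows the four edges at `v` to be colored last. -/
def IsGoodRoot (N : α → Finset α) (v : α) (Q : Finset (α × α)) : Prop :=
  (∀ q ∈ Q, q.1 ∈ N v ∧ q.2 ∈ N q.1 ∧ q.2 ≠ v) ∧
  (∀ q ∈ Q, ∀ q' ∈ Q, q ≠ q' → Separated N q q') ∧
  ∃ u₁ u₂ u₃ u₄, N v = {u₁, u₂, u₃, u₄} ∧
    3 ≤ squareCount N v u₁ + (Q.card - 1) ∧ 2 ≤ squareCount N v u₂ + (Q.card - 1) ∧
    1 ≤ squareCount N v u₃ + (Q.card - 1)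

variable {N : α → Finset α} {K : Set α}

theorem exists_eq_insert_of_card_four {s : Finset α} (hs : s.card = 4) {a b : α}
    (ha : a ∈ s) (hb : b ∈ s) (hab : a ≠ b) :
    ∃ c d, s = {a, b, c, d} ∧ a ≠ c ∧ a ≠ d ∧ b ≠ c ∧ b ≠ d ∧ c ≠ d := by
  have h2 : ((s.erase a).erase b).card = 2 := by
    rw [Finset.card_erase_of_mem (by simp [hb, hab.symm]), Finset.card_erase_of_mem ha, hs]
  obtain ⟨c, d, hcd, h⟩ := Finset.card_eq_two.1 h2
  have hc : c ∈ (s.erase a).erase b := by simp [h]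
  have hd : d ∈ (s.erase a).erase b := by simp [h]
  simp only [Finset.mem_erase] at hc hd
  refine ⟨c, d, ?_, hc.2.1.symm, hd.2.1.symm, hc.1.symm, hd.1.symm, hcd⟩
  rw [← h, Finset.insert_erase (by simp [hb, hab.symm]), Finset.insert_erase ha]

/-! ### Good roots in triangle-free 4-regular graphs, by the 4-cycles present -/

namespace IsTriangleFreeOn

theorem mem_squares {v u y w : α} :
    (y, w) ∈ ((N v).erase u ×ˢ (N u).erase v).filter (fun q => q.2 ∈ N q.1) ↔
      y ∈ N v ∧ y ≠ u ∧ w ∈ N u ∧ w ≠ v ∧ w ∈ N y := by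
  simp only [Finset.mem_filter, Finset.mem_product, Finset.mem_erase]
  tauto

theorem square_unique {v u y w y' w' : α} (hs : squareCount N v u ≤ 1)
    (h : y ∈ N v ∧ y ≠ u ∧ w ∈ N u ∧ w ≠ v ∧ w ∈ N y)
    (h' : y' ∈ N v ∧ y' ≠ u ∧ w' ∈ N u ∧ w' ≠ v ∧ w' ∈ N y') : y = y' ∧ w = w' := by
  have := Finset.card_le_one.1 hs _ (mem_squares.2 h) _ (mem_squares.2 h')
  simpa using this

theorem squareCount_pos {v u y w : α} (h : y ∈ N v ∧ y ≠ u ∧ w ∈ N u ∧ w ≠ v ∧ w ∈ N y) :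
    1 ≤ squareCount N v u :=
  Finset.card_pos.2 ⟨_, mem_squares.2 h⟩

theorem exists_square {v u : α} (h : 1 ≤ squareCount N v u) :
    ∃ y w, y ∈ N v ∧ y ≠ u ∧ w ∈ N u ∧ w ≠ v ∧ w ∈ N y := by
  obtain ⟨⟨y, w⟩, hq⟩ := Finset.card_pos.1 h
  exact ⟨y, w, mem_squares.1 hq⟩

variable (hK : IsTriangleFreeOn N K)
include hK

/-- If every two neighbors of `v` have a second common neighbor, then every edge at `v` lies on
three 4-cycles. -/
theorem isGoodRoot_of_common_neighbors {v : α} (hv : v ∈ K)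
    (h : ∀ y ∈ N v, ∀ y' ∈ N v, y ≠ y' → ∃ w, w ≠ v ∧ w ∈ N y ∧ w ∈ N y') :
    IsGoodRoot N v ∅ := by
  have key : ∀ u ∈ N v, 3 ≤ squareCount N v u := by
    intro u hu
    have hsub : (N v).erase u ⊆ (((N v).erase u ×ˢ (N u).erase v).filter
        fun q => q.2 ∈ N q.1).image Prod.fst := by
      intro y hy
      obtain ⟨hyu, hy⟩ := Finset.mem_erase.1 hy
      obtain ⟨w, hwv, hw, hw'⟩ := h y hy u hu hyu
      exact Finset.mem_image.2 ⟨(y, w), mem_squares.2 ⟨hy, hyu, hw', hwv, hw⟩, rfl⟩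
    calc 3 = ((N v).erase u).card := by rw [Finset.card_erase_of_mem hu, hK.card hv]
      _ ≤ _ := Finset.card_le_card hsub
      _ ≤ _ := Finset.card_image_le
  obtain ⟨a, ha, b, hb, hab⟩ := Finset.one_lt_card.1 (show 1 < (N v).card by rw [hK.card hv]; simp)
  obtain ⟨c, d, hN, -⟩ := exists_eq_insert_of_card_four (hK.card hv) ha hb hab
  have hc : c ∈ N v := by simp [hN]
  refine ⟨by simp, by simp, a, b, c, d, hN, ?_⟩
  have := key a ha
  have := key b hb
  have := key c hc
  simp
  omega

/-- An edge on two 4-cycles gives a good root. -/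
theorem exists_isGoodRoot_of_two_le {v u : α} (hv : v ∈ K) (hu : u ∈ N v)
    (h2 : 2 ≤ squareCount N v u) : ∃ v ∈ K, ∃ Q, IsGoodRoot N v Q := by
  by_cases hsep : ∃ y ∈ N v, ∃ w ∈ N y, ∃ y' ∈ N v, ∃ w' ∈ N y',
      w ≠ v ∧ w' ≠ v ∧ Separated N (y, w) (y', w')
  · obtain ⟨y, hy, w, hw, y', hy', w', hw', hwv, hwv', hs⟩ := hsep
    obtain ⟨t, z, ht, htu, hzu, hzv, hzt⟩ := exists_square (h2.trans' one_le_two)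
    -- The edge `vt` shares a 4-cycle with `vu`. With two edges in `Q` the savings are at least 2+1,
    -- 1+1 and 0+1.
    have h1 : 1 ≤ squareCount N v t := squareCount_pos ⟨hu, htu.symm, hzt, hzv, hzu⟩
    obtain ⟨c, d, hN, -⟩ := exists_eq_insert_of_card_four (hK.card hv) hu ht htu.symm
    have hne : (y, w) ≠ (y', w') := fun e => hs.1 (congrArg Prod.fst e)
    have hs' := hK.separated_symm (q := (y, w)) (hK.mem (hK.mem hv hy) hw) hs
    refine ⟨v, hv, {(y, w), (y', w')}, ?_, ?_, u, t, c, d, hN, ?_⟩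
    · simp only [Finset.mem_insert, Finset.mem_singleton]
      rintro q (rfl | rfl)
      exacts [⟨hy, hw, hwv⟩, ⟨hy', hw', hwv'⟩]
    · simp only [Finset.mem_insert, Finset.mem_singleton]
      rintro q (rfl | rfl) q' (rfl | rfl) hqq <;> first | exact absurd rfl hqq | assumption
    · rw [Finset.card_pair hne]
      omega
  · push Not at hsep
    by_cases hc : ∀ y ∈ N v, ∀ y' ∈ N v, y ≠ y' → ∃ w, w ≠ v ∧ w ∈ N y ∧ w ∈ N y'
    · exact ⟨v, hv, ∅, hK.isGoodRoot_of_common_neighbors hv hc⟩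
    · push Not at hc
      obtain ⟨y, hy, y', hy', hyy, hc⟩ := hc
      have hyK := hK.mem hv hy
      have hyK' := hK.mem hv hy'
      have hvy := hK.symm hv hy
      have hvy' := hK.symm hv hy'
      -- Since `y` and `y'` have only `v` in common, non-adjacent `w` and `w'` would give a
      -- separated pair.
      have hadj : ∀ w ∈ N y, w ≠ v → ∀ w' ∈ N y', w' ≠ v → w ∈ N w' := by
        intro w hw hwv w' hw' hwv'
        by_contra hcon
        exact hsep y hy w hw y' hy' w' hw' hwv hwv'
          ⟨hyy, hc w hwv hw, fun h => hc w' hwv' h hw', hcon⟩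
      have h3 : 1 < ((N y).erase v).card := by
        rw [Finset.card_erase_of_mem hvy, hK.card hyK]; simp
      obtain ⟨w, hw, w₂, hw₂, h12⟩ := Finset.one_lt_card.1 h3
      simp only [Finset.mem_erase] at hw hw₂
      have hwK := hK.mem hyK hw.2
      refine ⟨w, hwK, ∅, hK.isGoodRoot_of_common_neighbors hwK ?_⟩
      -- All neighbors of `y` other than `v` thus have this same neighborhood, so the twin `w₂` of
      -- `w` is a second common neighbor of any two neighbors of `w`.
      have hNw : N w = insert y ((N y').erase v) := by
        symm
        apply Finset.eq_of_subset_of_card_le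
        · intro z hz
          rcases Finset.mem_insert.1 hz with rfl | hz
          · exact hK.symm hyK hw.2
          · obtain ⟨hzv, hz⟩ := Finset.mem_erase.1 hz
            exact hK.symm (hK.mem hyK' hz) (hadj w hw.2 hw.1 z hz hzv)
        · rw [Finset.card_insert_of_notMem, Finset.card_erase_of_mem hvy', hK.card hyK',
            hK.card hwK]
          intro h
          exact hK.tri hv hy' hy (Finset.mem_erase.1 h).2
      have hw₂N : ∀ z ∈ N w, w₂ ∈ N z := by
        intro z hz
        rw [hNw] at hz
        rcases Finset.mem_insert.1 hz with rfl | hz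
        · exact hw₂.2
        · obtain ⟨hzv, hz⟩ := Finset.mem_erase.1 hz
          exact hadj w₂ hw₂.2 hw₂.1 z hz hzv
      exact fun z hz t ht _ => ⟨w₂, h12.symm, hw₂N z hz, hw₂N t ht⟩

/-- If every edge lies on at most one 4-cycle, a 4-cycle gives a good root. -/
theorem exists_isGoodRoot_of_square (hle : ∀ v ∈ K, ∀ u ∈ N v, squareCount N v u ≤ 1)
    {v u₁ u₂ x : α} (hv : v ∈ K) (hu₁ : u₁ ∈ N v) (hu₂ : u₂ ∈ N v) (h12 : u₂ ≠ u₁)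
    (hx₁ : x ∈ N u₁) (hxv : x ≠ v) (hx₂ : x ∈ N u₂) : ∃ Q, IsGoodRoot N v Q := by
  obtain ⟨u₃, u₄, hN, h13, h14, h23, h24, h34⟩ :=
    exists_eq_insert_of_card_four (hK.card hv) hu₁ hu₂ h12.symm
  have hu₃ : u₃ ∈ N v := by simp [hN]
  have hu₄ : u₄ ∈ N v := by simp [hN]
  have K₁ := hK.mem hv hu₁
  have K₂ := hK.mem hv hu₂
  have K₃ := hK.mem hv hu₃
  have K₄ := hK.mem hv hu₄
  have v₁ := hK.symm hv hu₁
  have v₂ := hK.symm hv hu₂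
  -- Three separated edges suffice: `vu₁` and `vu₂` lie on the 4-cycle through `x`, so the savings
  -- are at least 1+2, 1+2 and 0+2.
  have finish : ∀ i ∈ N v, ∀ p ∈ N i, p ≠ v → ∀ b ∈ N u₃, b ≠ v → ∀ c ∈ N u₄, c ≠ v →
      Separated N (i, p) (u₃, b) → Separated N (i, p) (u₄, c) → Separated N (u₃, b) (u₄, c) →
      ∃ Q, IsGoodRoot N v Q := by
    intro i hi p hp hpv b hb hbv c hc hcv s1 s2 s3
    have hpK := hK.mem (hK.mem hv hi) hp
    have hbK := hK.mem K₃ hb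
    have s1' := hK.separated_symm (q := (i, p)) hpK s1
    have s2' := hK.separated_symm (q := (i, p)) hpK s2
    have s3' := hK.separated_symm (q := (u₃, b)) hbK s3
    have hcard : ({(i, p), (u₃, b), (u₄, c)} : Finset (α × α)).card = 3 := by
      rw [Finset.card_eq_three]
      exact ⟨_, _, _, fun e => s1.1 (congrArg Prod.fst e), fun e => s2.1 (congrArg Prod.fst e),
        fun e => s3.1 (congrArg Prod.fst e), rfl⟩
    refine ⟨{(i, p), (u₃, b), (u₄, c)}, ?_, ?_, u₁, u₂, u₃, u₄, hN, ?_⟩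
    · simp only [Finset.mem_insert, Finset.mem_singleton]
      rintro q (rfl | rfl | rfl)
      exacts [⟨hi, hp, hpv⟩, ⟨hu₃, hb, hbv⟩, ⟨hu₄, hc, hcv⟩]
    · simp only [Finset.mem_insert, Finset.mem_singleton]
      rintro q (rfl | rfl | rfl) q' (rfl | rfl | rfl) hqq <;>
        first | exact absurd rfl hqq | assumption
    · rw [hcard]
      have := squareCount_pos (N := N) ⟨hu₂, h12, hx₁, hxv, hx₂⟩
      omega
  -- `u₁` and `u₂` have no neighbor other than `v` in common with `u₃` and `u₄`
  have far₁ : ∀ j ∈ N v, j ≠ u₁ → j ≠ u₂ → ∀ w ∈ N u₁, w ≠ v → w ∉ N j := by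
    intro j hj hj1 hj2 w hw hwv hwj
    exact hj2 (square_unique (hle v hv u₁ hu₁) ⟨hj, hj1, hw, hwv, hwj⟩
      ⟨hu₂, h12, hx₁, hxv, hx₂⟩).1
  have far₂ : ∀ j ∈ N v, j ≠ u₁ → j ≠ u₂ → ∀ w ∈ N u₂, w ≠ v → w ∉ N j := by
    intro j hj hj1 hj2 w hw hwv hwj
    exact hj1 (square_unique (hle v hv u₂ hu₂) ⟨hj, hj2, hw, hwv, hwj⟩
      ⟨hu₁, h12.symm, hx₂, hxv, hx₁⟩).1
  have far : ∀ i ∈ N v, (i = u₁ ∨ i = u₂) → ∀ j ∈ N v, j ≠ u₁ → j ≠ u₂ → ∀ w ∈ N i, w ≠ v →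
      ∀ w' ∈ N j, w' ≠ v → w ∉ N w' → Separated N (i, w) (j, w') := by
    rintro i hi (rfl | rfl) j hj hj1 hj2 w hw hwv w' hw' hwv' hww
    · exact ⟨hj1.symm, far₁ j hj hj1 hj2 w hw hwv,
        fun h => far₁ j hj hj1 hj2 w' h hwv' hw', hww⟩
    · exact ⟨hj2.symm, far₂ j hj hj1 hj2 w hw hwv,
        fun h => far₂ j hj hj1 hj2 w' h hwv' hw', hww⟩
  -- Each of `u₃`, `u₄` has two private neighbors besides `v`. Were `b, b'` both adjacent to `c,
  -- c'`, the edge `bc` would lie on the 4-cycles `b c b' c'` and `b c b' u₃`.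
  have hpair : ∃ b ∈ N u₃, b ≠ v ∧ ∃ c ∈ N u₄, c ≠ v ∧ Separated N (u₃, b) (u₄, c) := by
    have two : ∀ i ∈ N v, ∀ j ∈ N v, i ≠ j → 1 < (((N i).erase v) \ N j).card := by
      intro i hi j hj hij
      have h1 : (((N i).erase v) ∩ N j).card ≤ 1 := by
        rw [Finset.card_le_one]
        intro a ha b hb
        simp only [Finset.mem_inter, Finset.mem_erase] at ha hb
        exact (square_unique (hle v hv i hi) ⟨hj, hij.symm, ha.1.2, ha.1.1, ha.2⟩
          ⟨hj, hij.symm, hb.1.2, hb.1.1, hb.2⟩).2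
      have h2 := Finset.card_sdiff_add_card_inter ((N i).erase v) (N j)
      rw [Finset.card_erase_of_mem (hK.symm hv hi), hK.card (hK.mem hv hi)] at h2
      omega
    obtain ⟨b, hb, b', hb', hbb⟩ := Finset.one_lt_card.1 (two u₃ hu₃ u₄ hu₄ h34)
    obtain ⟨c, hc, c', hc', hcc⟩ := Finset.one_lt_card.1 (two u₄ hu₄ u₃ hu₃ h34.symm)
    simp only [Finset.mem_sdiff, Finset.mem_erase] at hb hb' hc hc'
    by_contra hcon
    have adj : ∀ b c, ((b ≠ v ∧ b ∈ N u₃) ∧ b ∉ N u₄) → ((c ≠ v ∧ c ∈ N u₄) ∧ c ∉ N u₃) →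
        b ∈ N c := by
      intro b c hb hc
      by_contra h
      exact hcon ⟨b, hb.1.2, hb.1.1, c, hc.1.2, hc.1.1, h34, hb.2, hc.2, h⟩
    have Kb := hK.mem K₃ hb.1.2
    have Kc := hK.mem K₄ hc.1.2
    have Kc' := hK.mem K₄ hc'.1.2
    have hcb := hK.symm Kc (adj b c hb hc)
    have e := (square_unique (hle b Kb c hcb)
      ⟨hK.symm Kc' (adj b c' hb hc'), hcc.symm, adj b' c hb' hc, hbb.symm, adj b' c' hb' hc'⟩
      ⟨hK.symm K₃ hb.1.2, fun e => hK.tri hv hu₄ hu₃ (e ▸ hc.1.2), adj b' c hb' hc, hbb.symm,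
        hb'.1.2⟩).1
    exact hK.tri hv hu₄ hu₃ (e ▸ hc'.1.2)
  obtain ⟨b, hb, hbv, c, hc, hcv, hbc⟩ := hpair
  -- if `x` is adjacent to one of the two edges, some other neighbor of `u₁` or `u₂` is not
  have avoid : ∀ b c, b ∈ K → c ∈ K → x ∈ N b → b ≠ u₁ → b ≠ u₂ →
      (∃ j ∈ N v, j ∈ N c ∧ j ∉ N u₁ ∧ j ∉ N u₂) →
      ∃ i ∈ N v, (i = u₁ ∨ i = u₂) ∧ ∃ p ∈ N i, p ≠ v ∧ p ∉ N b ∧ p ∉ N c := by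
    intro b c Kb Kc hxb hb₁ hb₂ ⟨j, hj, hjc, hj₁, hj₂⟩
    -- The edge `ix` already lies on the 4-cycle through `v` and `i'`; adjacency of `p` and `b`
    -- would give it a second one, `i x b p`.
    have nb : ∀ i ∈ N v, ∀ i' ∈ N v, i' ≠ i → x ∈ N i → x ∈ N i' → b ≠ i → b ≠ i' →
        ∀ p ∈ N i, p ≠ v → p ≠ x → p ∉ N b := by
      intro i hi i' hi' hii hxi hxi' hbi hbi' p hp hpv hpx hpb
      have Ki := hK.mem hv hi
      exact hpv (square_unique (hle i Ki x hxi)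
        ⟨hp, hpx, hK.symm Kb hxb, hbi, hK.symm Kb hpb⟩
        ⟨hK.symm hv hi, hxv.symm, hK.symm (hK.mem hv hi') hxi', hii, hi'⟩).1
    by_contra hcon
    push Not at hcon
    have c₁ : ∀ p ∈ N u₁, p ≠ v → p ≠ x → p ∈ N c := fun p hp hpv hpx =>
      hcon u₁ hu₁ (Or.inl rfl) p hp hpv (nb u₁ hu₁ u₂ hu₂ h12 hx₁ hx₂ hb₁ hb₂ p hp hpv hpx)
    have c₂ : ∀ p ∈ N u₂, p ≠ v → p ≠ x → p ∈ N c := fun p hp hpv hpx =>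
      hcon u₂ hu₂ (Or.inr rfl) p hp hpv
        (nb u₂ hu₂ u₁ hu₁ h12.symm hx₂ hx₁ hb₂ hb₁ p hp hpv hpx)
    -- Five distinct neighbors of `c`: the vertex `j`, and two from each of `u₁` and `u₂`.
    have hsub : insert j ((((N u₁).erase v).erase x) ∪ (((N u₂).erase v).erase x)) ⊆ N c := by
      intro p hp
      simp only [Finset.mem_insert, Finset.mem_union, Finset.mem_erase] at hp
      rcases hp with rfl | ⟨h1, h2, h3⟩ | ⟨h1, h2, h3⟩
      · exact hjc
      · exact c₁ p h3 h2 h1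
      · exact c₂ p h3 h2 h1
    have hle' := Finset.card_le_card hsub
    rw [Finset.card_insert_of_notMem (by simp [hj₁, hj₂]), Finset.card_union_of_disjoint,
      Finset.card_erase_of_mem (by simp [hx₁, hxv]), Finset.card_erase_of_mem v₁,
      Finset.card_erase_of_mem (by simp [hx₂, hxv]), Finset.card_erase_of_mem v₂,
      hK.card K₁, hK.card K₂, hK.card Kc] at hle'
    · omega
    · rw [Finset.disjoint_left]
      intro p hp hp'
      simp only [Finset.mem_erase] at hp hp'
      exact hp.1 (square_unique (hle v hv u₁ hu₁) ⟨hu₂, h12, hp.2.2, hp.2.1, hp'.2.2⟩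
        ⟨hu₂, h12, hx₁, hxv, hx₂⟩).2
  have Kb := hK.mem K₃ hb
  have Kc := hK.mem K₄ hc
  have close : ∀ i ∈ N v, (i = u₁ ∨ i = u₂) → ∀ p ∈ N i, p ≠ v → p ∉ N b → p ∉ N c →
      ∃ Q, IsGoodRoot N v Q := fun i hi h12 p hp hpv hpb hpc =>
    finish i hi p hp hpv b hb hbv c hc hcv (far i hi h12 u₃ hu₃ h13.symm h23.symm p hp hpv b hb
      hbv hpb) (far i hi h12 u₄ hu₄ h14.symm h24.symm p hp hpv c hc hcv hpc) hbc
  have hne : ∀ i ∈ N v, ∀ j ∈ N v, ∀ w ∈ N j, w ≠ i := fun i hi j hj w hw e =>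
    hK.tri hv hj hi (e ▸ hw)
  by_cases hxb : x ∈ N b
  · obtain ⟨i, hi, h12, p, hp, hpv, hpb, hpc⟩ := avoid b c Kb Kc hxb (hne _ hu₁ _ hu₃ b hb)
      (hne _ hu₂ _ hu₃ b hb) ⟨u₄, hu₄, hK.symm K₄ hc, hK.tri hv hu₁ hu₄, hK.tri hv hu₂ hu₄⟩
    exact close i hi h12 p hp hpv hpb hpc
  by_cases hxc : x ∈ N c
  · obtain ⟨i, hi, h12, p, hp, hpv, hpc, hpb⟩ := avoid c b Kc Kb hxc (hne _ hu₁ _ hu₄ c hc)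
      (hne _ hu₂ _ hu₄ c hc) ⟨u₃, hu₃, hK.symm K₃ hb, hK.tri hv hu₁ hu₃, hK.tri hv hu₂ hu₃⟩
    exact close i hi h12 p hp hpv hpb hpc
  exact close u₁ hu₁ (Or.inl rfl) x hx₁ hxv hxb hxc

/-- Without 4-cycles every vertex is a good root. -/
theorem exists_isGoodRoot_of_no_square
    (hno : ∀ v ∈ K, ∀ u ∈ N v, ∀ y ∈ N v, y ≠ u → ∀ w ∈ N u, w ≠ v → w ∉ N y)
    {v : α} (hv : v ∈ K) : ∃ Q, IsGoodRoot N v Q := by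
  obtain ⟨u₁, hu₁, u₂, hu₂, h12⟩ :=
    Finset.one_lt_card.1 (show 1 < (N v).card by rw [hK.card hv]; simp)
  obtain ⟨u₃, u₄, hN, h13, h14, h23, h24, h34⟩ :=
    exists_eq_insert_of_card_four (hK.card hv) hu₁ hu₂ h12
  have hu₃ : u₃ ∈ N v := by simp [hN]
  have hu₄ : u₄ ∈ N v := by simp [hN]
  have K₁ := hK.mem hv hu₁
  have K₂ := hK.mem hv hu₂
  have K₃ := hK.mem hv hu₃
  have K₄ := hK.mem hv hu₄
  have v₄ := hK.symm hv hu₄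
  have hone : ∀ j ∈ N v, ∀ w ∈ K, w ≠ j → ∀ p ∈ N j, ∀ p' ∈ N j, w ∈ N p → w ∈ N p' →
      p = p' := by
    intro j hj w hw hwj p hp p' hp' h h'
    by_contra hpp
    have Kj := hK.mem hv hj
    exact hno p (hK.mem Kj hp) j (hK.symm Kj hp) w h hwj p' hp' (Ne.symm hpp)
      (hK.symm (hK.mem Kj hp') h')
  have hne : ∀ i ∈ N v, ∀ j ∈ N v, ∀ w ∈ N j, w ≠ i := fun i hi j hj w hw e =>
    hK.tri hv hj hi (e ▸ hw)
  obtain ⟨d, hd⟩ : ((N u₄).erase v).Nonempty := by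
    rw [← Finset.card_pos, Finset.card_erase_of_mem v₄, hK.card K₄]
    simp
  obtain ⟨hdv, hd⟩ := Finset.mem_erase.1 hd
  have Kd := hK.mem K₄ hd
  -- Two neighbors of `i` adjacent to `d` would close a 4-cycle, so `d` rules out at most one of the
  -- three candidates.
  have two : ∀ i ∈ N v, 1 < (((N i).erase v).filter fun w => w ∉ N d).card := by
    intro i hi
    have h1 : (((N i).erase v).filter fun w => w ∈ N d).card ≤ 1 := by
      rw [Finset.card_le_one]
      intro a ha b hb
      simp only [Finset.mem_filter, Finset.mem_erase] at ha hb
      exact hone i hi d Kd (hne i hi u₄ hu₄ d hd) a ha.1.2 b hb.1.2 (hK.symm Kd ha.2)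
        (hK.symm Kd hb.2)
    have h2 := Finset.card_filter_add_card_filter_not (s := (N i).erase v) (fun w => w ∈ N d)
    rw [Finset.card_erase_of_mem (hK.symm hv hi), hK.card (hK.mem hv hi)] at h2
    omega
  have hA : ∀ i ∈ N v, ∀ a ∈ ((N i).erase v).filter (fun w => w ∉ N d),
      a ∈ K ∧ a ∈ N i ∧ a ≠ v ∧ a ∉ N d := by
    intro i hi a ha
    simp only [Finset.mem_filter, Finset.mem_erase] at ha
    exact ⟨hK.mem (hK.mem hv hi) ha.1.2, ha.1.2, ha.1.1, ha.2⟩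
  have m1 : ∀ i ∈ N v, ∀ j ∈ N v, ∀ a ∈ ((N i).erase v).filter (fun w => w ∉ N d),
      ∀ b ∈ ((N j).erase v).filter (fun w => w ∉ N d),
      ∀ b' ∈ ((N j).erase v).filter (fun w => w ∉ N d), a ∈ N b → a ∈ N b' → b = b' := by
    intro i hi j hj a ha b hb b' hb' h h'
    exact hone j hj a (hA i hi a ha).1 (hne j hj i hi a (hA i hi a ha).2.1) b (hA j hj b hb).2.1
      b' (hA j hj b' hb').2.1 h h'
  have m2 : ∀ i ∈ N v, ∀ j ∈ N v, ∀ b ∈ ((N j).erase v).filter (fun w => w ∉ N d),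
      ∀ a ∈ ((N i).erase v).filter (fun w => w ∉ N d),
      ∀ a' ∈ ((N i).erase v).filter (fun w => w ∉ N d), a ∈ N b → a' ∈ N b → a = a' := by
    intro i hi j hj b hb a ha a' ha' h h'
    have Kb := (hA j hj b hb).1
    exact m1 j hj i hi b hb a ha a' ha' (hK.symm Kb h) (hK.symm Kb h')
  obtain ⟨a, ha, b, hb, c, hc, hab, hac, hbc⟩ := exists_independent_transversal
    (r := fun a b => a ∈ N b) (two u₁ hu₁) (two u₂ hu₂) (two u₃ hu₃)
    (m1 u₁ hu₁ u₂ hu₂) (m1 u₁ hu₁ u₃ hu₃) (m2 u₁ hu₁ u₃ hu₃)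
    (m1 u₂ hu₂ u₃ hu₃) (m2 u₂ hu₂ u₃ hu₃) (by
      intro a ha b hb c hc hab hac hbc
      exact hK.tri (hA _ hu₃ c hc).1 hbc hac hab)
  obtain ⟨Ka, ha, hav, had⟩ := hA _ hu₁ a ha
  obtain ⟨Kb, hb, hbv, hbd⟩ := hA _ hu₂ b hb
  obtain ⟨Kc, hc, hcv, hcd⟩ := hA _ hu₃ c hc
  have sep : ∀ i ∈ N v, ∀ j ∈ N v, i ≠ j → ∀ w ∈ N i, w ≠ v → ∀ w' ∈ N j, w' ≠ v → w ∉ N w' →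
      Separated N (i, w) (j, w') := fun i hi j hj hij w hw hwv w' hw' hwv' h =>
    ⟨hij, hno v hv i hi j hj hij.symm w hw hwv, hno v hv j hj i hi hij w' hw' hwv', h⟩
  have s12 := sep _ hu₁ _ hu₂ h12 a ha hav b hb hbv hab
  have s13 := sep _ hu₁ _ hu₃ h13 a ha hav c hc hcv hac
  have s14 := sep _ hu₁ _ hu₄ h14 a ha hav d hd hdv had
  have s23 := sep _ hu₂ _ hu₃ h23 b hb hbv c hc hcv hbc
  have s24 := sep _ hu₂ _ hu₄ h24 b hb hbv d hd hdv hbd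
  have s34 := sep _ hu₃ _ hu₄ h34 c hc hcv d hd hdv hcd
  have s21 := hK.separated_symm (q := (u₁, a)) Ka s12
  have s31 := hK.separated_symm (q := (u₁, a)) Ka s13
  have s41 := hK.separated_symm (q := (u₁, a)) Ka s14
  have s32 := hK.separated_symm (q := (u₂, b)) Kb s23
  have s42 := hK.separated_symm (q := (u₂, b)) Kb s24
  have s43 := hK.separated_symm (q := (u₃, c)) Kc s34
  refine ⟨{(u₁, a), (u₂, b), (u₃, c), (u₄, d)}, ?_, ?_, u₁, u₂, u₃, u₄, hN, ?_⟩
  · simp only [Finset.mem_insert, Finset.mem_singleton]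
    rintro q (rfl | rfl | rfl | rfl)
    exacts [⟨hu₁, ha, hav⟩, ⟨hu₂, hb, hbv⟩, ⟨hu₃, hc, hcv⟩, ⟨hu₄, hd, hdv⟩]
  · simp only [Finset.mem_insert, Finset.mem_singleton]
    rintro q (rfl | rfl | rfl | rfl) q' (rfl | rfl | rfl | rfl) hqq <;>
      first | exact absurd rfl hqq | assumption
  -- Four edges of one color save 3 for every edge at `v`, without any 4-cycle.
  · rw [Finset.card_insert_of_notMem (by simp [h12, h13, h14]),
      Finset.card_insert_of_notMem (by simp [h23, h24]),
      Finset.card_insert_of_notMem (by simp [h34]), Finset.card_singleton]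
    omega

theorem exists_isGoodRoot (hne : K.Nonempty) : ∃ v ∈ K, ∃ Q, IsGoodRoot N v Q := by
  by_cases h2 : ∃ v ∈ K, ∃ u ∈ N v, 2 ≤ squareCount N v u
  · obtain ⟨v, hv, u, hu, h⟩ := h2
    exact hK.exists_isGoodRoot_of_two_le hv hu h
  push Not at h2
  by_cases h1 : ∃ v ∈ K, ∃ u ∈ N v, 1 ≤ squareCount N v u
  · obtain ⟨v, hv, u, hu, h⟩ := h1
    obtain ⟨y, w, hy, hyu, hw, hwv, hwy⟩ := exists_square h
    exact ⟨v, hv, hK.exists_isGoodRoot_of_square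
      (fun v hv u hu => Nat.lt_succ_iff.1 (h2 v hv u hu)) hv hu hy hyu hw hwv hwy⟩
  push Not at h1
  obtain ⟨v, hv⟩ := hne
  refine ⟨v, hv, hK.exists_isGoodRoot_of_no_square ?_ hv⟩
  intro v hv u hu y hy hyu w hw hwv hwy
  exact absurd (squareCount_pos ⟨hy, hyu, hw, hwv, hwy⟩) (h1 v hv u hu).not_ge

end IsTriangleFreeOn

end StrongEdgeColoring

/-! ### Conflicts in multigraphs and how many there are -/

namespace Graph

variable {α β : Type*} {G : Graph α β}

/-- Two edges are in conflict if they have a common endpoint or an edge joins their endpoints. -/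
def Conflict (G : Graph α β) (e f : β) : Prop :=
  ∃ x y, G.Inc e x ∧ G.Inc f y ∧ (x = y ∨ G.Adj x y)

theorem Conflict.symm {e f : β} : G.Conflict e f → G.Conflict f e := by
  rintro ⟨x, y, hx, hy, h⟩
  exact ⟨y, x, hy, hx, h.imp Eq.symm Adj.symm⟩

open Classical in
/-- The edges in `E` that are incident to `x`. -/
noncomputable def starFinset (G : Graph α β) (E : Finset β) (x : α) : Finset β :=
  E.filter fun e => G.Inc e x

open Classical in
/-- The edges in `E` that are in conflict with `e`. -/
noncomputable def conflictFinset (G : Graph α β) (E : Finset β) (e : β) : Finset β :=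
  E.filter fun f => f ≠ e ∧ G.Conflict e f

open Classical in
/-- The edges in `E` that share no endpoint with `e` but are incident to the endpoint opposite to
`x` of the edge `g`. -/
noncomputable def farFinset (G : Graph α β) (E : Finset β) (e g : β) (x : α) : Finset β :=
  E.filter fun f => (¬ ∃ z, G.Inc e z ∧ G.Inc f z) ∧ ∃ y, G.IsLink g x y ∧ G.Inc f y

/-- The vertex `v` can be used as the root of a greedy coloring, in which the edges of `P` get the
same color and the edges at `v` are colored last. -/
def IsRoot [DecidableEq β] (G : Graph α β) (E : Finset β) (v : α) : Prop :=
  ∃ P : Finset β, (∀ e ∈ P, ∀ f ∈ P, e ≠ f → ¬ G.Conflict e f) ∧ (∀ e ∈ P, ¬ G.Inc e v) ∧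
    ∀ S ⊆ G.starFinset E v, S.Nonempty → ∃ e ∈ S,
      (G.conflictFinset E e \ P).card + min 1 P.card ≤ 21 + (G.starFinset E v \ S).card

variable {E : Finset β}

theorem mem_starFinset (hE : ∀ e, e ∈ E ↔ e ∈ G.edgeSet) {e : β} {x : α} :
    e ∈ G.starFinset E x ↔ G.Inc e x := by
  simp only [starFinset, Finset.mem_filter, and_iff_right_iff_imp]
  exact fun h => (hE e).2 h.edge_mem

theorem mem_conflictFinset {e f : β} :
    f ∈ G.conflictFinset E e ↔ f ∈ E ∧ f ≠ e ∧ G.Conflict e f := by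
  simp [conflictFinset]

theorem sum_card_le {s : Finset β} {F : β → Finset β} {k : ℕ} (hs : s.card ≤ k)
    (h3 : ∀ g ∈ s, (F g).card ≤ 3) : ∑ g ∈ s, (F g).card ≤ 3 * k := by
  have h1 : ∑ g ∈ s, (F g).card ≤ s.card * 3 := Finset.sum_le_card_nsmul _ _ _ h3
  omega

theorem exists_adj_of_reflTransGen {T : α → Prop} {v x : α}
    (h : Relation.ReflTransGen G.Adj v x) (hv : ¬ T v) (hx : T x) :
    ∃ p a, G.Adj a p ∧ ¬ T p ∧ T a := by
  induction h with
  | refl => exact absurd hx hv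
  | @tail b c hb hbc ih =>
    by_cases hT : T b
    · exact ih hT
    · exact ⟨b, c, hbc.symm, hT, hx⟩

variable [DecidableEq β]

/-- A conflicting edge shares an end with `e` or is reached across an edge `g` at an end of `e`.
Intersecting with `S` lets the count be restricted to edges already colored. -/
theorem card_conflictFinset_inter_le (hE : ∀ e, e ∈ E ↔ e ∈ G.edgeSet) {e : β} {a b : α}
    (he : G.IsLink e a b) (S : Finset β) :
    (G.conflictFinset E e ∩ S).card ≤
      ((G.starFinset E a).erase e ∩ S).card + ((G.starFinset E b).erase e ∩ S).card +
      ∑ g ∈ (G.starFinset E a).erase e, (G.farFinset E e g a ∩ S).card +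
      ∑ g ∈ (G.starFinset E b).erase e, (G.farFinset E e g b ∩ S).card := by
  have hsub : G.conflictFinset E e ∩ S ⊆
      (((G.starFinset E a).erase e ∩ S) ∪ ((G.starFinset E b).erase e ∩ S)) ∪
      ((G.starFinset E a).erase e).biUnion (fun g => G.farFinset E e g a ∩ S) ∪
      ((G.starFinset E b).erase e).biUnion (fun g => G.farFinset E e g b ∩ S) := by
    intro f hf
    obtain ⟨hf, hfS⟩ := Finset.mem_inter.1 hf
    obtain ⟨hfE, hfe, x, y, hx, hy, hxy⟩ := mem_conflictFinset.1 hf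
    by_cases hz : ∃ z, G.Inc e z ∧ G.Inc f z
    · obtain ⟨z, hez, hfz⟩ := hz
      rcases hez.eq_or_eq_of_isLink he with rfl | rfl <;>
        simp [mem_starFinset hE, hfe, hfz, hfS]
    · rcases hxy with rfl | ⟨g, hg⟩
      · exact absurd ⟨x, hx, hy⟩ hz
      have hge : g ≠ e := by
        rintro rfl
        exact hz ⟨y, hg.inc_right, hy⟩
      have hfar : f ∈ G.farFinset E e g x := by
        simp only [farFinset, Finset.mem_filter]
        exact ⟨hfE, hz, y, hg, hy⟩
      rcases hx.eq_or_eq_of_isLink he with rfl | rfl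
      · refine Finset.mem_union_left _ (Finset.mem_union_right _ (Finset.mem_biUnion.2 ⟨g, ?_, ?_⟩))
        · simp [mem_starFinset hE, hge, hg.inc_left]
        · simp [hfar, hfS]
      · refine Finset.mem_union_right _ (Finset.mem_biUnion.2 ⟨g, ?_, ?_⟩)
        · simp [mem_starFinset hE, hge, hg.inc_left]
        · simp [hfar, hfS]
  refine (Finset.card_le_card hsub).trans ((Finset.card_union_le _ _).trans ?_)
  exact add_le_add ((Finset.card_union_le _ _).trans
    (add_le_add (Finset.card_union_le _ _) Finset.card_biUnion_le)) Finset.card_biUnion_le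

theorem card_farFinset_le (hE : ∀ e, e ∈ E ↔ e ∈ G.edgeSet)
    (hdeg : ∀ x, (G.starFinset E x).card ≤ 4) {e g : β} {x : α} (he : G.Inc e x)
    (hg : g ∈ (G.starFinset E x).erase e) : (G.farFinset E e g x).card ≤ 3 := by
  obtain ⟨y, hy⟩ := (mem_starFinset hE).1 (Finset.mem_of_mem_erase hg)
  have hsub : G.farFinset E e g x ⊆ (G.starFinset E y).erase g := by
    intro f hf
    simp only [farFinset, Finset.mem_filter] at hf
    obtain ⟨-, hz, y', hy', hf⟩ := hf
    obtain rfl := hy.right_unique hy'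
    refine Finset.mem_erase.2 ⟨?_, (mem_starFinset hE).2 hf⟩
    rintro rfl
    exact hz ⟨x, he, hy.inc_left⟩
  have h1 := Finset.card_le_card hsub
  rw [Finset.card_erase_of_mem ((mem_starFinset hE).2 hy.inc_right)] at h1
  have := hdeg y
  omega

theorem card_farFinset_le_of_parallel (hE : ∀ e, e ∈ E ↔ e ∈ G.edgeSet)
    (hdeg : ∀ x, (G.starFinset E x).card ≤ 4) {e g g' : β} {x y : α} (he : G.Inc e x)
    (hg : G.IsLink g x y) (hg' : G.IsLink g' x y) (hne : g ≠ g') :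
    (G.farFinset E e g x).card ≤ 2 := by
  have hsub : G.farFinset E e g x ⊆ ((G.starFinset E y).erase g).erase g' := by
    intro f hf
    simp only [farFinset, Finset.mem_filter] at hf
    obtain ⟨-, hz, y', hy', hf⟩ := hf
    obtain rfl := hg.right_unique hy'
    refine Finset.mem_erase.2 ⟨?_, Finset.mem_erase.2 ⟨?_, (mem_starFinset hE).2 hf⟩⟩
    · rintro rfl
      exact hz ⟨x, he, hg'.inc_left⟩
    · rintro rfl
      exact hz ⟨x, he, hg.inc_left⟩
  have h1 := Finset.card_le_card hsub
  rw [Finset.card_erase_of_mem (Finset.mem_erase.2 ⟨hne.symm, (mem_starFinset hE).2 hg'.inc_right⟩),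
    Finset.card_erase_of_mem ((mem_starFinset hE).2 hg.inc_right)] at h1
  have := hdeg y
  omega

theorem sum_card_le_of_exceptional {s : Finset β} {F : β → Finset β} {k m : ℕ}
    (hs : s.card ≤ k + 1) (h3 : ∀ g ∈ s, (F g).card ≤ 3) {g₀ : β} (hg₀ : g₀ ∈ s)
    (hm : (F g₀).card ≤ m) : ∑ g ∈ s, (F g).card ≤ m + 3 * k := by
  rw [← Finset.add_sum_erase _ _ hg₀]
  have h1 : ∑ g ∈ s.erase g₀, (F g).card ≤ (s.erase g₀).card * 3 :=
    Finset.sum_le_card_nsmul _ _ _ fun g hg => h3 g (Finset.mem_of_mem_erase hg)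
  rw [Finset.card_erase_of_mem hg₀] at h1
  omega

theorem card_star_erase_le (hE : ∀ e, e ∈ E ↔ e ∈ G.edgeSet) {e : β} {x : α} {k : ℕ}
    (he : G.Inc e x) (h : (G.starFinset E x).card ≤ k + 1) :
    ((G.starFinset E x).erase e).card ≤ k := by
  rw [Finset.card_erase_of_mem ((mem_starFinset hE).2 he)]
  omega

/-- The edge joining `a` to `p` and the up to three other edges at `p` lie outside `S`, which lowers
the bound 24 to 20. -/
theorem card_conflictFinset_inter_le_of_disjoint (hE : ∀ e, e ∈ E ↔ e ∈ G.edgeSet)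
    (hdeg : ∀ x, (G.starFinset E x).card ≤ 4) {e : β} {a p : α} (hea : G.Inc e a)
    (hap : G.Adj a p) {S : Finset β} (heS : e ∈ S) (hS : ∀ f ∈ S, ¬ G.Inc f p) :
    (G.conflictFinset E e ∩ S).card ≤ 20 := by
  obtain ⟨b, hab⟩ := hea
  obtain ⟨g₀, hg₀⟩ := hap
  have hg₀e : g₀ ∈ (G.starFinset E a).erase e := by
    refine Finset.mem_erase.2 ⟨?_, (mem_starFinset hE).2 hg₀.inc_left⟩
    rintro rfl
    exact hS _ heS hg₀.inc_right
  have h := card_conflictFinset_inter_le hE hab S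
  have ha := card_star_erase_le hE hab.inc_left (hdeg a)
  have hb := card_star_erase_le hE hab.inc_right (hdeg b)
  have h1 : ((G.starFinset E a).erase e ∩ S).card ≤ 2 := by
    have hsub : (G.starFinset E a).erase e ∩ S ⊆ ((G.starFinset E a).erase e).erase g₀ := by
      intro f hf
      obtain ⟨hf, hfS⟩ := Finset.mem_inter.1 hf
      refine Finset.mem_erase.2 ⟨?_, hf⟩
      rintro rfl
      exact hS _ hfS hg₀.inc_right
    have := Finset.card_le_card hsub
    rw [Finset.card_erase_of_mem hg₀e] at this
    omega
  have h2 : ((G.starFinset E b).erase e ∩ S).card ≤ 3 :=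
    (Finset.card_le_card Finset.inter_subset_left).trans hb
  have far : ∀ x, G.Inc e x → ∀ g ∈ (G.starFinset E x).erase e,
      (G.farFinset E e g x ∩ S).card ≤ 3 := fun x hx g hg =>
    (Finset.card_le_card Finset.inter_subset_left).trans (card_farFinset_le hE hdeg hx hg)
  have h0 : (G.farFinset E e g₀ a ∩ S).card ≤ 0 := by
    rw [Nat.le_zero, Finset.card_eq_zero, Finset.eq_empty_iff_forall_notMem]
    intro f hf
    obtain ⟨hf, hfS⟩ := Finset.mem_inter.1 hf
    simp only [farFinset, Finset.mem_filter] at hf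
    obtain ⟨-, -, y, hy, hf⟩ := hf
    obtain rfl := hg₀.right_unique hy
    exact hS f hfS hf
  have h3 := sum_card_le_of_exceptional (k := 2) ha (far a hab.inc_left) hg₀e h0
  have h4 := sum_card_le hb (far b hab.inc_right)
  omega

theorem card_conflictFinset_le (hE : ∀ e, e ∈ E ↔ e ∈ G.edgeSet)
    (hdeg : ∀ x, (G.starFinset E x).card ≤ 4) {e : β} {a : α} {k : ℕ} (hea : G.Inc e a)
    (hk : (G.starFinset E a).card ≤ k + 1) :
    (G.conflictFinset E e).card ≤ 12 + 4 * k := by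
  obtain ⟨b, hab⟩ := hea
  have h := card_conflictFinset_inter_le hE hab (G.conflictFinset E e)
  rw [Finset.inter_self] at h
  have ha := card_star_erase_le hE hab.inc_left hk
  have hb := card_star_erase_le hE hab.inc_right (hdeg b)
  have far : ∀ x, G.Inc e x → ∀ g ∈ (G.starFinset E x).erase e,
      (G.farFinset E e g x ∩ G.conflictFinset E e).card ≤ 3 := fun x hx g hg =>
    (Finset.card_le_card Finset.inter_subset_left).trans (card_farFinset_le hE hdeg hx hg)
  have h1 := (Finset.card_le_card (Finset.inter_subset_left
    (s₁ := (G.starFinset E a).erase e) (s₂ := G.conflictFinset E e))).trans ha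
  have h2 := (Finset.card_le_card (Finset.inter_subset_left
    (s₁ := (G.starFinset E b).erase e) (s₂ := G.conflictFinset E e))).trans hb
  have h3 := sum_card_le ha (far a hab.inc_left)
  have h4 := sum_card_le hb (far b hab.inc_right)
  omega

/-- An edge `g` at `a` that brings only `m` new conflicts for the edge `e` at `a`. -/
theorem card_conflictFinset_le_of_exceptional (hE : ∀ e, e ∈ E ↔ e ∈ G.edgeSet)
    (hdeg : ∀ x, (G.starFinset E x).card ≤ 4) {e g : β} {a : α} {m : ℕ} (hea : G.Inc e a)
    (hg : G.Inc g a) (hge : g ≠ e) (hm : (G.farFinset E e g a).card ≤ m) :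
    (G.conflictFinset E e).card ≤ 21 + m := by
  obtain ⟨b, hab⟩ := hea
  have h := card_conflictFinset_inter_le hE hab (G.conflictFinset E e)
  rw [Finset.inter_self] at h
  have ha := card_star_erase_le hE hab.inc_left (hdeg a)
  have hb := card_star_erase_le hE hab.inc_right (hdeg b)
  have far : ∀ x, G.Inc e x → ∀ g ∈ (G.starFinset E x).erase e,
      (G.farFinset E e g x ∩ G.conflictFinset E e).card ≤ 3 := fun x hx g hg =>
    (Finset.card_le_card Finset.inter_subset_left).trans (card_farFinset_le hE hdeg hx hg)
  have h1 := (Finset.card_le_card (Finset.inter_subset_left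
    (s₁ := (G.starFinset E a).erase e) (s₂ := G.conflictFinset E e))).trans ha
  have h2 := (Finset.card_le_card (Finset.inter_subset_left
    (s₁ := (G.starFinset E b).erase e) (s₂ := G.conflictFinset E e))).trans hb
  have h3 := sum_card_le_of_exceptional (k := 2) ha (far a hab.inc_left)
    (Finset.mem_erase.2 ⟨hge, (mem_starFinset hE).2 hg⟩)
    ((Finset.card_le_card Finset.inter_subset_left).trans hm)
  have h4 := sum_card_le hb (far b hab.inc_right)
  omega

/-! ### Greedy coloring from a root -/

/-- The component of a root can be colored greedily. -/
theorem IsRoot.exists_coloring (hE : ∀ e, e ∈ E ↔ e ∈ G.edgeSet)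
    (hdeg : ∀ x, (G.starFinset E x).card ≤ 4) {v : α} (hv : G.IsRoot E v) :
    ∃ c : β → Fin 22, ∀ e f, (∃ x, G.Inc e x ∧ Relation.ReflTransGen G.Adj v x) →
      (∃ x, G.Inc f x ∧ Relation.ReflTransGen G.Adj v x) → e ≠ f → G.Conflict e f →
      c e ≠ c f := by
  obtain ⟨P, hP, hPv, hroot⟩ := hv
  have key : ∀ n, ∀ S : Finset β, S.card = n → S ⊆ E → Disjoint S P →
      (∀ e ∈ S, ∃ x, G.Inc e x ∧ Relation.ReflTransGen G.Adj v x) →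
      ∃ c : β → Fin 22, (∀ e ∈ P, c e = 0) ∧
        ∀ e ∈ S ∪ P, ∀ f ∈ S ∪ P, e ≠ f → G.Conflict e f → c e ≠ c f := by
    intro n
    induction n with
    | zero =>
      intro S hS _ _ _
      obtain rfl := Finset.card_eq_zero.1 hS
      refine ⟨fun _ => 0, fun _ _ => rfl, fun e he f hf hef hc => ?_⟩
      rw [Finset.empty_union] at he hf
      exact absurd hc (hP e he f hf hef)
    | succ n ih =>
      intro S hcard hSE hSP hreach
      -- The edge `e` is to be colored last among `S`. The term `min 1 P.card` counts the single
      -- color used on `P`.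
      obtain ⟨e, heS, he⟩ : ∃ e ∈ S, (G.conflictFinset E e ∩ S).card + min 1 P.card ≤ 21 := by
        by_cases hSv : (S ∩ G.starFinset E v).Nonempty
        · obtain ⟨e, heS, he⟩ := hroot _ Finset.inter_subset_right hSv
          obtain ⟨heS, hev⟩ := Finset.mem_inter.1 heS
          refine ⟨e, heS, ?_⟩
          -- The edges at `v` outside `S` conflict with `e` but are still uncolored; they account
          -- for `(G.starFinset E v \ S).card` in the root condition.
          have hsub : (G.conflictFinset E e ∩ S) ∪
              (G.starFinset E v \ (S ∩ G.starFinset E v)) ⊆ G.conflictFinset E e \ P := by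
            intro f hf
            rcases Finset.mem_union.1 hf with hf | hf
            · obtain ⟨hf, hfS⟩ := Finset.mem_inter.1 hf
              exact Finset.mem_sdiff.2 ⟨hf, Finset.disjoint_left.1 hSP hfS⟩
            · obtain ⟨hfv, hf⟩ := Finset.mem_sdiff.1 hf
              have hfS : f ∉ S := fun h => hf (Finset.mem_inter.2 ⟨h, hfv⟩)
              have hfv' := (mem_starFinset hE).1 hfv
              refine Finset.mem_sdiff.2 ⟨mem_conflictFinset.2 ⟨(hE f).2 hfv'.edge_mem, ?_,
                v, v, (mem_starFinset hE).1 hev, hfv', Or.inl rfl⟩, fun h => hPv f h hfv'⟩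
              rintro rfl
              exact hfS heS
          have hcard' := Finset.card_le_card hsub
          rw [Finset.card_union_of_disjoint] at hcard'
          · omega
          · rw [Finset.disjoint_left]
            intro f hf hf'
            have h1 := (Finset.mem_inter.1 hf).2
            obtain ⟨h2, h3⟩ := Finset.mem_sdiff.1 hf'
            exact h3 (Finset.mem_inter.2 ⟨h1, h2⟩)
        · obtain ⟨e₀, he₀⟩ : S.Nonempty := by
            rw [← Finset.card_pos]
            omega
          obtain ⟨x, hx, hvx⟩ := hreach e₀ he₀
          -- A walk from `v`, which meets no edge of `S`, must step from some such `p` to a vertex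
          -- `a` that meets one.
          obtain ⟨p, a, hap, hp, e, heS, hea⟩ :=
            exists_adj_of_reflTransGen (T := fun x => ∃ f ∈ S, G.Inc f x) hvx
              (fun ⟨f, hf, hfv⟩ =>
                hSv ⟨f, Finset.mem_inter.2 ⟨hf, (mem_starFinset hE).2 hfv⟩⟩) ⟨e₀, he₀, hx⟩
          refine ⟨e, heS, ?_⟩
          have := card_conflictFinset_inter_le_of_disjoint hE hdeg hea hap heS
            (fun f hf hfp => hp ⟨f, hf, hfp⟩)
          have := min_le_left 1 P.card
          omega
      obtain ⟨c, hc0, hc⟩ := ih (S.erase e) (by rw [Finset.card_erase_of_mem heS]; omega)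
        ((Finset.erase_subset _ _).trans hSE) (hSP.mono_left (Finset.erase_subset _ _))
        (fun f hf => hreach f (Finset.mem_of_mem_erase hf))
      have heP : e ∉ P := Finset.disjoint_left.1 hSP heS
      have hPcard : (P.image c).card ≤ min 1 P.card := by
        refine le_min ?_ Finset.card_image_le
        have : P.image c ⊆ {0} := by
          intro k hk
          obtain ⟨f, hf, rfl⟩ := Finset.mem_image.1 hk
          exact Finset.mem_singleton.2 (hc0 f hf)
        simpa using Finset.card_le_card this
      obtain ⟨k, hk⟩ : ∃ k, k ∉ (G.conflictFinset E e ∩ S).image c ∪ P.image c := by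
        by_contra hcon
        push Not at hcon
        have h1 : (Finset.univ : Finset (Fin 22)).card ≤ _ :=
          Finset.card_le_card (fun k _ => hcon k)
        have h2 := h1.trans (Finset.card_union_le _ _)
        have h3 : ((G.conflictFinset E e ∩ S).image c).card ≤ _ := Finset.card_image_le
        simp only [Finset.card_univ, Fintype.card_fin] at h2
        omega
      have hk' : ∀ f ∈ S ∪ P, f ≠ e → G.Conflict e f → k ≠ c f := by
        rintro f hf hfe hef rfl
        apply hk
        rcases Finset.mem_union.1 hf with hf | hf
        · exact Finset.mem_union_left _ (Finset.mem_image_of_mem _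
            (Finset.mem_inter.2 ⟨mem_conflictFinset.2 ⟨hSE hf, hfe, hef⟩, hf⟩))
        · exact Finset.mem_union_right _ (Finset.mem_image_of_mem _ hf)
      have hmem : ∀ f ∈ S ∪ P, f ≠ e → f ∈ S.erase e ∪ P := by
        intro f hf hfe
        rcases Finset.mem_union.1 hf with hf | hf
        · exact Finset.mem_union_left _ (Finset.mem_erase.2 ⟨hfe, hf⟩)
        · exact Finset.mem_union_right _ hf
      refine ⟨Function.update c e k, fun f hf => ?_, fun f hf f' hf' hff hconf => ?_⟩
      · rw [Function.update_of_ne (ne_of_mem_of_not_mem hf heP)]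
        exact hc0 f hf
      · by_cases h : f = e
        · subst h
          rw [Function.update_self, Function.update_of_ne hff.symm]
          exact hk' f' hf' hff.symm hconf
        · rw [Function.update_of_ne h]
          by_cases h' : f' = e
          · subst h'
            rw [Function.update_self]
            exact (hk' f hf h hconf.symm).symm
          · rw [Function.update_of_ne h']
            exact hc f (hmem f hf h) f' (hmem f' hf' h') hff hconf
  classical
  obtain ⟨c, -, hc⟩ := key _ ((E.filter fun e => ∃ x, G.Inc e x ∧
    Relation.ReflTransGen G.Adj v x) \ P) rfl
    (Finset.sdiff_subset.trans (Finset.filter_subset _ _)) Finset.sdiff_disjoint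
    (fun e he => (Finset.mem_filter.1 (Finset.mem_sdiff.1 he).1).2)
  have hmem : ∀ e, (∃ x, G.Inc e x ∧ Relation.ReflTransGen G.Adj v x) →
      e ∈ ((E.filter fun e => ∃ x, G.Inc e x ∧ Relation.ReflTransGen G.Adj v x) \ P) ∪ P := by
    intro e he
    rw [Finset.sdiff_union_self_eq_union]
    obtain ⟨x, hx, -⟩ := id he
    exact Finset.mem_union_left _ (Finset.mem_filter.2 ⟨(hE e).2 hx.edge_mem, he⟩)
  exact ⟨c, fun e f he hf => hc e (hmem e he) f (hmem f hf)⟩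

/-- A coloring exists as soon as every component contains a root. -/
theorem exists_isStrongEdgeColoring_of_isRoot (hE : ∀ e, e ∈ E ↔ e ∈ G.edgeSet)
    (hdeg : ∀ x, (G.starFinset E x).card ≤ 4)
    (hroot : ∀ x ∈ G.vertexSet, ∃ v, Relation.ReflTransGen G.Adj x v ∧ G.IsRoot E v) :
    ∃ c : β → Fin 22, G.IsStrongEdgeColoring c := by
  have hsymm : ∀ {x y}, Relation.ReflTransGen G.Adj x y → Relation.ReflTransGen G.Adj y x := by
    intro x y h
    induction h with
    | refl => exact .refl
    | tail _ hbc ih => exact ih.head hbc.symm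
  let s : Setoid α := ⟨Relation.ReflTransGen G.Adj, fun _ => .refl,
    hsymm, fun h h' => h.trans h'⟩
  have hcol : ∀ x : α, ∃ c : β → Fin 22, ∀ e f,
      (∃ y, G.Inc e y ∧ Relation.ReflTransGen G.Adj x y) →
      (∃ y, G.Inc f y ∧ Relation.ReflTransGen G.Adj x y) → e ≠ f → G.Conflict e f →
      c e ≠ c f := by
    intro x
    by_cases hx : x ∈ G.vertexSet
    · obtain ⟨v, hxv, hv⟩ := hroot x hx
      obtain ⟨c, hc⟩ := hv.exists_coloring hE hdeg
      have hvx : Relation.ReflTransGen G.Adj v x := hsymm hxv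
      exact ⟨c, fun e f ⟨y, hey, hy⟩ ⟨z, hfz, hz⟩ =>
        hc e f ⟨y, hey, hvx.trans hy⟩ ⟨z, hfz, hvx.trans hz⟩⟩
    · refine ⟨fun _ => 0, fun e f ⟨y, hey, hy⟩ => ?_⟩
      rcases hy.cases_head with rfl | ⟨z, hz, -⟩
      · exact absurd hey.vertex_mem hx
      · exact absurd hz.left_mem hx
  choose col hcol using hcol
  -- Conflicting edges lie in one component, so the colorings of the components, indexed by
  -- representatives, can be glued.
  let rep : α → α := fun x => (Quotient.mk s x).out
  have hrep : ∀ x, Relation.ReflTransGen G.Adj (rep x) x := fun x =>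
    Quotient.exact (Quotient.out_eq (Quotient.mk s x))
  have hrep_eq : ∀ {x y}, Relation.ReflTransGen G.Adj x y → rep x = rep y := fun h =>
    congrArg Quotient.out (Quotient.sound (s := s) h)
  classical
  let c : β → Fin 22 := fun e => if h : ∃ x, G.Inc e x then col (rep h.choose) e else 0
  have hinc : ∀ {e x y}, G.Inc e x → G.Inc e y → Relation.ReflTransGen G.Adj x y := by
    rintro e x y ⟨z, hz⟩ hy
    rcases hy.eq_or_eq_of_isLink hz with rfl | rfl
    · exact .refl
    · exact .single hz.adj
  have hc : ∀ {e x}, G.Inc e x → c e = col (rep x) e := by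
    intro e x hx
    have h : ∃ x, G.Inc e x := ⟨x, hx⟩
    simp only [c, dif_pos h]
    rw [hrep_eq (hinc h.choose_spec hx)]
  have hmain : ∀ e f, e ≠ f → G.Conflict e f → c e ≠ c f := by
    rintro e f hef ⟨x, y, hx, hy, hxy⟩
    have hxy' : Relation.ReflTransGen G.Adj x y := by
      rcases hxy with rfl | h
      · exact .refl
      · exact .single h
    rw [hc hx, hc hy, ← hrep_eq hxy']
    exact hcol (rep x) e f ⟨x, hx, hrep x⟩ ⟨y, hy, (hrep x).trans hxy'⟩ hef ⟨x, y, hx, hy, hxy⟩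
  refine ⟨c, fun e f x he hf hef => hmain e f hef ⟨x, x, he, hf, Or.inl rfl⟩, ?_⟩
  intro e g f w x y z he hg hf hef
  exact hmain e f hef ⟨x, y, he.inc_right, hf.inc_left, Or.inr hg.adj⟩

end Graph

/-! ### Roots at low degree, parallel edges and triangles; conflicts and 4-cycles -/

namespace Graph

open StrongEdgeColoring

variable {α β : Type*} [DecidableEq β] {G : Graph α β} {E : Finset β}

theorem IsRoot.of_card_star_le_three (hE : ∀ e, e ∈ E ↔ e ∈ G.edgeSet)
    (hdeg : ∀ x, (G.starFinset E x).card ≤ 4) {v : α} (hv : (G.starFinset E v).card ≤ 3) :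
    G.IsRoot E v := by
  refine ⟨∅, by simp, by simp, fun S hS ⟨e, he⟩ => ⟨e, he, ?_⟩⟩
  have := card_conflictFinset_le (k := 2) hE hdeg ((mem_starFinset hE).1 (hS he)) hv
  rw [Finset.sdiff_empty, Finset.card_empty]
  omega

/-- The edges are colored in the order `e₄, e₃, e₂, e₁`. Nothing is asked of `e₄`, as 24 conflicts
are compensated by three uncolored companions. The truncated `P.card - 1` is the saving from the
common color, and is 0 for empty `P` too. -/
theorem IsRoot.of_star_eq (hE : ∀ e, e ∈ E ↔ e ∈ G.edgeSet)
    (hdeg : ∀ x, (G.starFinset E x).card ≤ 4) {v : α}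
    (hv : (G.starFinset E v).card = 4) {e₁ e₂ e₃ e₄ : β}
    (hstar : G.starFinset E v = {e₁, e₂, e₃, e₄}) {P : Finset β}
    (hP : ∀ e ∈ P, ∀ f ∈ P, e ≠ f → ¬ G.Conflict e f) (hPv : ∀ e ∈ P, ¬ G.Inc e v)
    (hPE : ∀ e ∈ G.starFinset E v, P ⊆ G.conflictFinset E e)
    (h₁ : (G.conflictFinset E e₁).card ≤ 21 + (P.card - 1))
    (h₂ : (G.conflictFinset E e₂).card ≤ 22 + (P.card - 1))
    (h₃ : (G.conflictFinset E e₃).card ≤ 23 + (P.card - 1)) : G.IsRoot E v := by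
  refine ⟨P, hP, hPv, fun S hS hne => ?_⟩
  have hsd : (G.starFinset E v \ S).card = 4 - S.card := by
    rw [Finset.card_sdiff_of_subset hS, hv]
  have hPcard : ∀ e ∈ G.starFinset E v, (G.conflictFinset E e \ P).card + P.card =
      (G.conflictFinset E e).card := by
    intro e he
    rw [Finset.card_sdiff_of_subset (hPE e he), Nat.sub_add_cancel
      (Finset.card_le_card (hPE e he))]
  by_cases m₁ : e₁ ∈ S
  · refine ⟨e₁, m₁, ?_⟩
    have := hPcard e₁ (hS m₁)
    omega
  have hS₁ : S ⊆ {e₂, e₃, e₄} := by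
    intro f hf
    have := hS hf
    rw [hstar, Finset.mem_insert] at this
    exact this.resolve_left (ne_of_mem_of_not_mem hf m₁)
  have c₁ := (Finset.card_le_card hS₁).trans Finset.card_le_three
  by_cases m₂ : e₂ ∈ S
  · refine ⟨e₂, m₂, ?_⟩
    have := hPcard e₂ (hS m₂)
    omega
  have hS₂ : S ⊆ {e₃, e₄} := by
    intro f hf
    exact (Finset.mem_insert.1 (hS₁ hf)).resolve_left (ne_of_mem_of_not_mem hf m₂)
  have c₂ := (Finset.card_le_card hS₂).trans Finset.card_le_two
  by_cases m₃ : e₃ ∈ S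
  · refine ⟨e₃, m₃, ?_⟩
    have := hPcard e₃ (hS m₃)
    omega
  have hS₃ : S ⊆ {e₄} := by
    intro f hf
    exact (Finset.mem_insert.1 (hS₂ hf)).resolve_left (ne_of_mem_of_not_mem hf m₃)
  have c₃ := (Finset.card_le_card hS₃).trans_eq (Finset.card_singleton _)
  obtain ⟨f, hf⟩ := hne
  refine ⟨f, hf, ?_⟩
  have := hPcard f (hS hf)
  have := card_conflictFinset_le (k := 3) hE hdeg ((mem_starFinset hE).1 (hS hf)) hv.le
  omega

/-- Everything beyond `e₂` already shares the end `u` with `e₁`, and vice versa, so both have at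
most 21 conflicts. A third edge at `v` meets at most two new edges beyond `e₂`, which gives 23. -/
theorem IsRoot.of_parallel (hE : ∀ e, e ∈ E ↔ e ∈ G.edgeSet)
    (hdeg : ∀ x, (G.starFinset E x).card ≤ 4) {v u : α} {e₁ e₂ : β} (h₁ : G.IsLink e₁ v u)
    (h₂ : G.IsLink e₂ v u) (hne : e₁ ≠ e₂) : G.IsRoot E v := by
  rcases (hdeg v).lt_or_eq with hlt | hv
  · exact .of_card_star_le_three hE hdeg (Nat.lt_succ_iff.1 hlt)
  obtain ⟨e₃, e₄, hstar, -, -, h23, -⟩ := exists_eq_insert_of_card_four hv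
    ((mem_starFinset hE).2 h₁.inc_left) ((mem_starFinset hE).2 h₂.inc_left) hne
  have par : ∀ e e', G.IsLink e v u → G.IsLink e' v u → e ≠ e' →
      (G.conflictFinset E e).card ≤ 21 := by
    intro e e' he he' hee
    refine card_conflictFinset_le_of_exceptional (m := 0) hE hdeg he.inc_left he'.inc_left
      hee.symm ?_
    rw [Nat.le_zero, Finset.card_eq_zero, Finset.eq_empty_iff_forall_notMem]
    intro f hf
    simp only [farFinset, Finset.mem_filter] at hf
    obtain ⟨-, hz, y, hy, hfy⟩ := hf
    obtain rfl := he'.right_unique hy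
    exact hz ⟨u, he.inc_right, hfy⟩
  have hi₃ : G.Inc e₃ v := (mem_starFinset hE).1 (by simp [hstar])
  refine .of_star_eq hE hdeg hv hstar (P := ∅) (by simp) (by simp) (by simp) ?_ ?_ ?_
  · have := par e₁ e₂ h₁ h₂ hne
    omega
  · have := par e₂ e₁ h₂ h₁ hne.symm
    omega
  · have := card_conflictFinset_le_of_exceptional hE hdeg hi₃ h₂.inc_left h23
      (card_farFinset_le_of_parallel hE hdeg hi₃ h₂ h₁ hne.symm)
    omega

/-- Edges with both endpoints in `Y` are counted twice by the degree sum over `Y`. -/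
theorem card_biUnion_star_add_card_le [DecidableEq α] (hE : ∀ e, e ∈ E ↔ e ∈ G.edgeSet)
    {Y : Finset α} {D : Finset β}
    (hD : ∀ f ∈ D, ∃ y ∈ Y, ∃ z ∈ Y, y ≠ z ∧ G.IsLink f y z) :
    (Y.biUnion (G.starFinset E)).card + D.card ≤ ∑ y ∈ Y, (G.starFinset E y).card := by
  classical
  have hDU : D ⊆ Y.biUnion (G.starFinset E) := by
    intro f hf
    obtain ⟨y, hy, z, -, -, h⟩ := hD f hf
    exact Finset.mem_biUnion.2 ⟨y, hy, (mem_starFinset hE).2 h.inc_left⟩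
  have h1 : ∑ y ∈ Y, (G.starFinset E y).card =
      ∑ f ∈ Y.biUnion (G.starFinset E), (Y.filter fun y => G.Inc f y).card := by
    have := Finset.sum_card_bipartiteAbove_eq_sum_card_bipartiteBelow
      (s := Y) (t := Y.biUnion (G.starFinset E)) (fun y f => G.Inc f y)
    refine Eq.trans (Finset.sum_congr rfl fun y hy => congrArg Finset.card ?_) this
    ext f
    simp only [Finset.bipartiteAbove, Finset.mem_filter, mem_starFinset hE, Finset.mem_biUnion]
    exact ⟨fun h => ⟨⟨y, hy, h⟩, h⟩, fun h => h.2⟩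
  have h2 : (Y.biUnion (G.starFinset E)).card + D.card =
      ∑ f ∈ Y.biUnion (G.starFinset E), (1 + if f ∈ D then 1 else 0) := by
    rw [Finset.sum_add_distrib, Finset.sum_const, smul_eq_mul, mul_one, Finset.sum_ite_mem,
      Finset.inter_eq_right.2 hDU, Finset.sum_const, smul_eq_mul, mul_one]
  rw [h1, h2]
  refine Finset.sum_le_sum fun f hf => ?_
  split_ifs with hfD
  · obtain ⟨y, hy, z, hz, hyz, h⟩ := hD f hfD
    exact Finset.one_lt_card.2 ⟨y, by simp [hy, h.inc_left], z, by simp [hz, h.inc_right], hyz⟩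
  · obtain ⟨y, hy, h⟩ := Finset.mem_biUnion.1 hf
    exact Finset.card_pos.2 ⟨y, by simp [hy, (mem_starFinset hE).1 h]⟩

/-- On the set `K`, closed under adjacency, the graph `G` is simple and 4-regular with neighborhood
function `N`. -/
structure IsSimpleFourRegularOn (G : Graph α β) (E : Finset β) (N : α → Finset α) (K : Set α) :
    Prop where
  mem_iff : ∀ ⦃x y⦄, y ∈ N x ↔ G.Adj x y
  mem : ∀ ⦃x y⦄, x ∈ K → G.Adj x y → y ∈ K
  card : ∀ ⦃x⦄, x ∈ K → (N x).card = 4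
  card_star : ∀ ⦃x⦄, x ∈ K → (G.starFinset E x).card = 4
  ne : ∀ ⦃e x y⦄, x ∈ K → G.IsLink e x y → x ≠ y
  unique : ∀ ⦃e f x y⦄, x ∈ K → G.IsLink e x y → G.IsLink f x y → e = f

namespace IsSimpleFourRegularOn

variable {N : α → Finset α} {K : Set α} (hG : G.IsSimpleFourRegularOn E N K)
  (hE : ∀ e, e ∈ E ↔ e ∈ G.edgeSet)

include hG hE

/-- The edge `e` and its conflicts lie in the stars of `N v ∪ N u`. The at least 7 edges at `v` or
`u`, and those of `D`, have both ends there and are counted twice in the degree sum. The 8 is 7 plus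
`e` itself. -/
theorem card_conflictFinset_add_le [DecidableEq α] (hdeg : ∀ x, (G.starFinset E x).card ≤ 4)
    {e : β} {v u : α} (hv : v ∈ K) (he : G.IsLink e v u) {D : Finset β}
    (hD : ∀ f ∈ D, ∃ y ∈ N v ∪ N u, ∃ z ∈ N v ∪ N u, y ≠ z ∧ G.IsLink f y z)
    (hDv : ∀ f ∈ D, ¬ G.Inc f v) (hDu : ∀ f ∈ D, ¬ G.Inc f u) :
    (G.conflictFinset E e).card + 8 + D.card ≤ 4 * (N v ∪ N u).card := by
  have hu : u ∈ K := hG.mem hv he.adj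
  have hsub : insert e (G.conflictFinset E e) ⊆ (N v ∪ N u).biUnion (G.starFinset E) := by
    intro f hf
    rw [Finset.mem_biUnion]
    rcases Finset.mem_insert.1 hf with rfl | hf
    · exact ⟨u, Finset.mem_union_left _ (hG.mem_iff.2 he.adj), (mem_starFinset hE).2 he.inc_right⟩
    · obtain ⟨-, -, x, y, hx, hy, hxy⟩ := mem_conflictFinset.1 hf
      have key : ∃ y, G.Inc f y ∧ (G.Adj v y ∨ G.Adj u y) := by
        rcases hxy with rfl | hxy
        · rcases hx.eq_or_eq_of_isLink he with rfl | rfl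
          · exact ⟨x, hy, Or.inr he.symm.adj⟩
          · exact ⟨x, hy, Or.inl he.adj⟩
        · rcases hx.eq_or_eq_of_isLink he with rfl | rfl
          · exact ⟨y, hy, Or.inl hxy⟩
          · exact ⟨y, hy, Or.inr hxy⟩
      obtain ⟨y, hy, h⟩ := key
      exact ⟨y, Finset.mem_union.2 (h.imp (fun h => hG.mem_iff.2 h) (fun h => hG.mem_iff.2 h)), (mem_starFinset hE).2 hy⟩
  have h1 := Finset.card_le_card hsub
  rw [Finset.card_insert_of_notMem (by simp [mem_conflictFinset])] at h1
  have hD' : ∀ f ∈ (G.starFinset E v ∪ G.starFinset E u) ∪ D,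
      ∃ y ∈ N v ∪ N u, ∃ z ∈ N v ∪ N u, y ≠ z ∧ G.IsLink f y z := by
    intro f hf
    rcases Finset.mem_union.1 hf with hf | hf
    · rcases Finset.mem_union.1 hf with hf | hf
      · obtain ⟨y, hy⟩ := (mem_starFinset hE).1 hf
        exact ⟨v, Finset.mem_union_right _ (hG.mem_iff.2 he.symm.adj), y,
          Finset.mem_union_left _ (hG.mem_iff.2 hy.adj), hG.ne hv hy, hy⟩
      · obtain ⟨y, hy⟩ := (mem_starFinset hE).1 hf
        exact ⟨u, Finset.mem_union_left _ (hG.mem_iff.2 he.adj), y,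
          Finset.mem_union_right _ (hG.mem_iff.2 hy.adj), hG.ne hu hy, hy⟩
    · exact hD f hf
  have h2 := card_biUnion_star_add_card_le hE hD'
  have h3 : ∑ y ∈ N v ∪ N u, (G.starFinset E y).card ≤ (N v ∪ N u).card * 4 :=
    Finset.sum_le_card_nsmul _ _ _ fun y _ => hdeg y
  have h4 : (G.starFinset E v ∩ G.starFinset E u).card ≤ 1 := by
    rw [Finset.card_le_one]
    intro a ha b hb
    simp only [Finset.mem_inter, mem_starFinset hE] at ha hb
    have link : ∀ a, G.Inc a v → G.Inc a u → G.IsLink a v u := by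
      rintro a ⟨y, hy⟩ hau
      rcases hau.eq_or_eq_of_isLink hy with rfl | rfl
      · exact absurd rfl (hG.ne hv he)
      · exact hy
    exact hG.unique hv (link a ha.1 ha.2) (link b hb.1 hb.2)
  have h5 := Finset.card_union_add_card_inter (G.starFinset E v) (G.starFinset E u)
  rw [hG.card_star hv, hG.card_star hu] at h5
  rw [Finset.card_union_of_disjoint (s := G.starFinset E v ∪ G.starFinset E u)] at h2
  · omega
  · rw [Finset.disjoint_right]
    intro f hf hf'
    rcases Finset.mem_union.1 hf' with hf' | hf'
    · exact hDv f hf ((mem_starFinset hE).1 hf')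
    · exact hDu f hf ((mem_starFinset hE).1 hf')

theorem star_eq [DecidableEq α] {v u₁ u₂ u₃ u₄ : α} (hv : v ∈ K) (hN : N v = {u₁, u₂, u₃, u₄}) :
    ∃ e₁ e₂ e₃ e₄, G.IsLink e₁ v u₁ ∧ G.IsLink e₂ v u₂ ∧ G.IsLink e₃ v u₃ ∧ G.IsLink e₄ v u₄ ∧
      G.starFinset E v = {e₁, e₂, e₃, e₄} := by
  obtain ⟨e₁, h₁⟩ : G.Adj v u₁ := hG.mem_iff.1 (by simp [hN])
  obtain ⟨e₂, h₂⟩ : G.Adj v u₂ := hG.mem_iff.1 (by simp [hN])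
  obtain ⟨e₃, h₃⟩ : G.Adj v u₃ := hG.mem_iff.1 (by simp [hN])
  obtain ⟨e₄, h₄⟩ : G.Adj v u₄ := hG.mem_iff.1 (by simp [hN])
  refine ⟨e₁, e₂, e₃, e₄, h₁, h₂, h₃, h₄, ?_⟩
  ext f
  simp only [Finset.mem_insert, Finset.mem_singleton, mem_starFinset hE]
  constructor
  · rintro ⟨y, hy⟩
    have : y ∈ N v := hG.mem_iff.2 hy.adj
    simp only [hN, Finset.mem_insert, Finset.mem_singleton] at this
    rcases this with rfl | rfl | rfl | rfl
    · exact Or.inl (hG.unique hv hy h₁)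
    · exact Or.inr (Or.inl (hG.unique hv hy h₂))
    · exact Or.inr (Or.inr (Or.inl (hG.unique hv hy h₃)))
    · exact Or.inr (Or.inr (Or.inr (hG.unique hv hy h₄)))
  · rintro (rfl | rfl | rfl | rfl)
    exacts [h₁.inc_left, h₂.inc_left, h₃.inc_left, h₄.inc_left]

/-- A triangle on `vy` makes `N v` and `N y` overlap, so the degree sum bounds the conflicts of `vy`
by 20, and likewise for `vz`. For a third edge `vp`, the edge `yz` inside `N v` is counted twice,
which gives 23. -/
theorem isRoot_of_triangle [DecidableEq α] (hdeg : ∀ x, (G.starFinset E x).card ≤ 4)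
    {v y z : α} (hv : v ∈ K) (hy : G.Adj v y) (hz : G.Adj v z) (hyz : G.Adj y z) :
    G.IsRoot E v := by
  have Ky := hG.mem hv hy
  have Kz := hG.mem hv hz
  obtain ⟨g, hg⟩ := hyz
  obtain ⟨p, q, hN, hyp, -, hzp, -⟩ := exists_eq_insert_of_card_four (hG.card hv)
    (hG.mem_iff.2 hy) (hG.mem_iff.2 hz) (hG.ne Ky hg)
  obtain ⟨e₁, e₂, e₃, e₄, h₁, h₂, h₃, -, hstar⟩ := hG.star_eq hE hv hN
  have Kp := hG.mem hv h₃.adj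
  have close : ∀ e y z, G.IsLink e v y → G.Adj v z → G.Adj y z →
      (G.conflictFinset E e).card ≤ 20 := by
    intro e y z he hz hyz
    have h := hG.card_conflictFinset_add_le hE hdeg hv he (D := ∅) (by simp) (by simp) (by simp)
    have h' := Finset.card_union_add_card_inter (N v) (N y)
    rw [hG.card hv, hG.card (hG.mem hv he.adj)] at h'
    have : 0 < (N v ∩ N y).card :=
      Finset.card_pos.2 ⟨z, Finset.mem_inter.2 ⟨hG.mem_iff.2 hz, hG.mem_iff.2 hyz⟩⟩
    rw [Finset.card_empty] at h
    omega
  have c₁ := close e₁ y z h₁ hz hg.adj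
  have c₂ := close e₂ z y h₂ hy hg.symm.adj
  have c₃ := hG.card_conflictFinset_add_le hE hdeg hv h₃ (D := {g})
    (by
      simp only [Finset.mem_singleton, forall_eq]
      exact ⟨y, Finset.mem_union_left _ (hG.mem_iff.2 hy), z,
        Finset.mem_union_left _ (hG.mem_iff.2 hz), hG.ne Ky hg, hg⟩)
    (by
      simp only [Finset.mem_singleton, forall_eq]
      intro h
      rcases h.eq_or_eq_of_isLink hg with rfl | rfl
      · exact hG.ne hv h₁ rfl
      · exact hG.ne hv h₂ rfl)
    (by
      simp only [Finset.mem_singleton, forall_eq]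
      intro h
      rcases h.eq_or_eq_of_isLink hg with rfl | rfl
      · exact hyp rfl
      · exact hzp rfl)
  have h8 := Finset.card_union_le (N v) (N p)
  rw [hG.card hv, hG.card Kp] at h8
  rw [Finset.card_singleton] at c₃
  exact .of_star_eq hE hdeg (hG.card_star hv) hstar (P := ∅) (by simp) (by simp) (by simp)
    (by omega) (by omega) (by omega)

/-- The edge opposite to `e` in a 4-cycle joins `N v` to `N u`, hence is counted twice in the degree
sum. Without triangles distinct 4-cycles through `e` have distinct opposite edges. -/
theorem card_conflictFinset_add_squareCount_le [DecidableEq α]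
    (hK : IsTriangleFreeOn N K)
    (hdeg : ∀ x, (G.starFinset E x).card ≤ 4) {e : β} {v u : α} (hv : v ∈ K)
    (he : G.IsLink e v u) : (G.conflictFinset E e).card + squareCount N v u ≤ 24 := by
  have hu := hG.mem hv he.adj
  have hed : ∀ q : α × α, ∃ g, q.2 ∈ N q.1 → G.IsLink g q.1 q.2 := by
    intro q
    by_cases hq : q.2 ∈ N q.1
    · obtain ⟨g, hg⟩ := hG.mem_iff.1 hq
      exact ⟨g, fun _ => hg⟩
    · exact ⟨e, fun h => absurd h hq⟩
  choose ed hed using hed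
  set T := ((N v).erase u ×ˢ (N u).erase v).filter fun q => q.2 ∈ N q.1 with hT
  have hmem : ∀ q ∈ T, q.1 ∈ N v ∧ q.1 ≠ u ∧ q.2 ∈ N u ∧ q.2 ≠ v ∧ q.2 ∈ N q.1 :=
    fun q hq => IsTriangleFreeOn.mem_squares.1 hq
  have hlink : ∀ q ∈ T, G.IsLink (ed q) q.1 q.2 := fun q hq => hed q (hmem q hq).2.2.2.2
  have hinj : (T.image ed).card = T.card := by
    refine Finset.card_image_of_injOn fun q hq q' hq' hqq => ?_
    have l := hlink q hq
    have l' := hlink q' hq'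
    have m := hmem q hq
    have m' := hmem q' hq'
    rw [← hqq] at l'
    rcases l.eq_and_eq_or_eq_and_eq l' with ⟨h1, h2⟩ | ⟨h1, h2⟩
    · exact Prod.ext h1 h2
    · exact absurd (h2 ▸ m.2.2.2.2) (hK.tri hv m.1 m'.1)
  have h := hG.card_conflictFinset_add_le hE hdeg hv he (D := T.image ed)
    (by
      intro f hf
      obtain ⟨q, hq, rfl⟩ := Finset.mem_image.1 hf
      have m := hmem q hq
      exact ⟨q.1, Finset.mem_union_left _ m.1, q.2, Finset.mem_union_right _ m.2.2.1,
        hG.ne (hK.mem hv m.1) (hlink q hq), hlink q hq⟩)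
    (by
      intro f hf h
      obtain ⟨q, hq, rfl⟩ := Finset.mem_image.1 hf
      have m := hmem q hq
      rcases h.eq_or_eq_of_isLink (hlink q hq) with h | h
      · obtain ⟨g, hg⟩ := hG.mem_iff.1 m.1
        exact hG.ne hv hg h
      · exact m.2.2.2.1 h.symm)
    (by
      intro f hf h
      obtain ⟨q, hq, rfl⟩ := Finset.mem_image.1 hf
      have m := hmem q hq
      rcases h.eq_or_eq_of_isLink (hlink q hq) with h | h
      · exact m.2.1 h.symm
      · obtain ⟨g, hg⟩ := hG.mem_iff.1 m.2.2.1
        exact hG.ne hu hg h)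
  have h8 := Finset.card_union_le (N v) (N u)
  rw [hG.card hv, hG.card hu] at h8
  rw [hinj] at h
  have : squareCount N v u = T.card := rfl
  omega

/-- Subtracting 4-cycles from 24 turns the bounds 3, 2, 1 of `IsGoodRoot` into the 21, 22, 23 of
`IsRoot.of_star_eq`. -/
theorem isRoot_of_isGoodRoot [DecidableEq α] (hK : IsTriangleFreeOn N K)
    (hdeg : ∀ x, (G.starFinset E x).card ≤ 4) {v : α} (hv : v ∈ K) {Q : Finset (α × α)}
    (hQ : IsGoodRoot N v Q) : G.IsRoot E v := by
  obtain ⟨hQv, hQs, u₁, u₂, u₃, u₄, hN, s₁, s₂, s₃⟩ := hQ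
  obtain ⟨e₁, e₂, e₃, e₄, h₁, h₂, h₃, -, hstar⟩ := hG.star_eq hE hv hN
  -- The value `e₁` at non-adjacent pairs is a dummy that makes `ed` total.
  have hed : ∀ q : α × α, ∃ g, q.2 ∈ N q.1 → G.IsLink g q.1 q.2 := by
    intro q
    by_cases hq : q.2 ∈ N q.1
    · obtain ⟨g, hg⟩ := hG.mem_iff.1 hq
      exact ⟨g, fun _ => hg⟩
    · exact ⟨e₁, fun h => absurd h hq⟩
  choose ed hed using hed
  have hlink : ∀ q ∈ Q, G.IsLink (ed q) q.1 q.2 := fun q hq => hed q (hQv q hq).2.1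
  have hconf : ∀ q ∈ Q, ∀ q' ∈ Q, q ≠ q' → ¬ G.Conflict (ed q) (ed q') := by
    rintro q hq q' hq' hqq ⟨x, y, hx, hy, hxy⟩
    obtain ⟨d1, d2, d3, d4⟩ := hQs q hq q' hq' hqq
    obtain ⟨n1, n2, n3⟩ := hQv q hq
    obtain ⟨n1', n2', n3'⟩ := hQv q' hq'
    rcases hx.eq_or_eq_of_isLink (hlink q hq) with rfl | rfl <;>
      rcases hy.eq_or_eq_of_isLink (hlink q' hq') with rfl | rfl <;>
      rcases hxy with h | h
    · exact d1 h
    · exact hK.tri hv n1 n1' (hG.mem_iff.2 h)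
    · exact hK.tri hv n1' n1 (h ▸ n2')
    · exact d3 (hG.mem_iff.2 h)
    · exact hK.tri hv n1 n1' (h ▸ n2)
    · exact d2 (hG.mem_iff.2 h.symm)
    · exact d2 (h ▸ n2')
    · exact d4 (hG.mem_iff.2 h.symm)
  have hcard : (Q.image ed).card = Q.card := by
    refine Finset.card_image_of_injOn fun q hq q' hq' hqq => ?_
    by_contra hne
    refine hconf q hq q' hq' hne ⟨q.1, q.1, (hlink q hq).inc_left, ?_, Or.inl rfl⟩
    exact hqq ▸ (hlink q hq).inc_left
  have hPv : ∀ e ∈ Q.image ed, ¬ G.Inc e v := by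
    intro f hf h
    obtain ⟨q, hq, rfl⟩ := Finset.mem_image.1 hf
    obtain ⟨n1, n2, n3⟩ := hQv q hq
    rcases h.eq_or_eq_of_isLink (hlink q hq) with h | h
    · obtain ⟨g, hg⟩ := hG.mem_iff.1 n1
      exact hG.ne hv hg h
    · exact n3 h.symm
  have c₁ := hG.card_conflictFinset_add_squareCount_le hE hK hdeg hv h₁
  have c₂ := hG.card_conflictFinset_add_squareCount_le hE hK hdeg hv h₂
  have c₃ := hG.card_conflictFinset_add_squareCount_le hE hK hdeg hv h₃
  refine .of_star_eq hE hdeg (hG.card_star hv) hstar (P := Q.image ed) ?_ hPv ?_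
    (by omega) (by omega) (by omega)
  · intro e he f hf hef
    obtain ⟨q, hq, rfl⟩ := Finset.mem_image.1 he
    obtain ⟨q', hq', rfl⟩ := Finset.mem_image.1 hf
    exact hconf q hq q' hq' (fun h => hef (congrArg ed h))
  · intro e he f hf
    have hev := (mem_starFinset hE).1 he
    have hfe : f ≠ e := by
      rintro rfl
      exact hPv f hf hev
    obtain ⟨q, hq, rfl⟩ := Finset.mem_image.1 hf
    exact mem_conflictFinset.2 ⟨(hE _).2 (hlink q hq).edge_mem, hfe, v, q.1, hev,
      (hlink q hq).inc_left, Or.inr (hG.mem_iff.1 (hQv q hq).1)⟩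

end IsSimpleFourRegularOn

/-! ### Existence of roots and the final theorem -/

/-- Every component contains a root. -/
theorem exists_isRoot (hV : G.vertexSet.Finite) (hE : ∀ e, e ∈ E ↔ e ∈ G.edgeSet)
    (hdeg : ∀ x, (G.starFinset E x).card ≤ 4)
    (hloop : ∀ x e, G.IsLoopAt e x → (G.starFinset E x).card ≤ 3) (x : α) :
    ∃ v, Relation.ReflTransGen G.Adj x v ∧ G.IsRoot E v := by
  classical
  by_contra hcon
  push Not at hcon
  have hstar : ∀ v, Relation.ReflTransGen G.Adj x v → (G.starFinset E v).card = 4 := by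
    intro v hv
    by_contra h
    have := hdeg v
    exact hcon v hv (.of_card_star_le_three hE hdeg (by omega))
  have hG : G.IsSimpleFourRegularOn E (fun v => hV.toFinset.filter (G.Adj v))
      {v | Relation.ReflTransGen G.Adj x v} := by
    have hmem : ∀ ⦃x y⦄, y ∈ hV.toFinset.filter (G.Adj x) ↔ G.Adj x y := by
      intro x y
      simp only [Finset.mem_filter, Set.Finite.mem_toFinset, and_iff_right_iff_imp]
      exact fun h => h.right_mem
    have huniq : ∀ ⦃e f v y⦄, Relation.ReflTransGen G.Adj x v → G.IsLink e v y →
        G.IsLink f v y → e = f := by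
      intro e f v y hv he hf
      by_contra hne
      exact hcon v hv (.of_parallel hE hdeg he hf hne)
    refine ⟨hmem, fun v y hv h => hv.tail h, fun v hv => ?_, hstar, ?_, huniq⟩
    · rw [← hstar v hv]
      symm
      refine Finset.card_bij (fun g hg => ((mem_starFinset hE).1 hg).other) ?_ ?_ ?_
      · intro g hg
        exact hmem.2 ((mem_starFinset hE).1 hg).isLink_other.adj
      · intro g hg g' hg' h
        refine huniq hv ((mem_starFinset hE).1 hg).isLink_other ?_
        rw [h]
        exact ((mem_starFinset hE).1 hg').isLink_other
      · intro y hy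
        obtain ⟨g, hg⟩ := hmem.1 hy
        exact ⟨g, (mem_starFinset hE).2 hg.inc_left, hg.inc_left.isLink_other.right_unique hg⟩
    · rintro e v y hv he rfl
      have := hloop v e he
      have := hstar v hv
      omega
  have hK : IsTriangleFreeOn (fun v => hV.toFinset.filter (G.Adj v))
      {v | Relation.ReflTransGen G.Adj x v} :=
    ⟨fun v hv y hy => hG.mem hv (hG.mem_iff.1 hy), fun v _ y hy => hG.mem_iff.2
      (hG.mem_iff.1 hy).symm, hG.card, fun v hv y hy z hz hyz => hcon v hv
      (hG.isRoot_of_triangle hE hdeg hv (hG.mem_iff.1 hy) (hG.mem_iff.1 hz) (hG.mem_iff.1 hyz))⟩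
  obtain ⟨v, hv, Q, hQ⟩ := hK.exists_isGoodRoot ⟨x, .refl⟩
  exact hcon v hv (hG.isRoot_of_isGoodRoot hE hK hdeg hv hQ)

end Graph

theorem mainTheorem1 {α β : Type*} (G : Graph α β)
    (hV : G.vertexSet.Finite) (hE : G.edgeSet.Finite)
    (hdeg : ∀ v ∈ G.vertexSet, G.degree v ≤ 4) :
    ∃ c : β → Fin 22, G.IsStrongEdgeColoring c := by
  classical
  have hE' : ∀ e, e ∈ hE.toFinset ↔ e ∈ G.edgeSet := fun e => hE.mem_toFinset
  have hcoe : ∀ x, (G.incidenceSet x).encard = (G.starFinset hE.toFinset x).card := by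
    intro x
    rw [← Set.encard_coe_eq_coe_finsetCard]
    congr 1
    ext e
    simp [Graph.mem_starFinset hE']
  have hbound : ∀ x ∈ G.vertexSet,
      ((G.starFinset hE.toFinset x).card : ℕ∞) + (G.loopSet x).encard ≤ 4 := by
    intro x hx
    rw [← hcoe]
    exact hdeg x hx
  have hdeg' : ∀ x, (G.starFinset hE.toFinset x).card ≤ 4 := by
    intro x
    by_cases hx : x ∈ G.vertexSet
    · exact_mod_cast le_self_add.trans (hbound x hx)
    · rw [Finset.card_eq_zero.2]
      · simp
      · rw [Finset.eq_empty_iff_forall_notMem]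
        exact fun e he => hx ((Graph.mem_starFinset hE').1 he).vertex_mem
  -- A loop counts twice in the degree but once in `starFinset`, so its vertex falls under the case
  -- of at most 3 edges.
  have hloop : ∀ x e, G.IsLoopAt e x → (G.starFinset hE.toFinset x).card ≤ 3 := by
    intro x e he
    have h1 : (1 : ℕ∞) ≤ (G.loopSet x).encard :=
      Set.one_le_encard_iff_nonempty.2 ⟨e, he⟩
    have h2 : (((G.starFinset hE.toFinset x).card + 1 : ℕ) : ℕ∞) ≤ 4 := by
      push_cast
      exact (add_le_add_right h1 _).trans (hbound x he.vertex_mem)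
    have h3 : (G.starFinset hE.toFinset x).card + 1 ≤ 4 := by exact_mod_cast h2
    omega
  exact Graph.exists_isStrongEdgeColoring_of_isRoot hE' hdeg'
    (fun x _ => Graph.exists_isRoot hV hE' hdeg' hloop x)
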